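/- All graphs are finite and simple. **Eternal Vertex Cover.** Guards are placed on vertices of a graph $H$, at most one on each vertex. In each round an edge $uv$ is attacked; in response every guard stays where it is or moves to a neighbouring vertex, so that at least one guard moves from $u$ to $v$ or from $v$ to $u$, and again no two guards share a vertex. The eternal vertex cover number $\operatorname{evc}(H)$ is the minimum number of guards with which every infinite sequence of attacks, not known in advance, can be defended. An instance of *Eternal Vertex Cover* is a graph $H$ and a positive integer $\ell$; the parameter is $\ell$, and the question is whether $\operatorname{evc}(H)\le \ell$. **Red Blue Dominating Set.** An instance is a bipartite graph $G=(R\cup B,E)$ and an integer $k\ge 0$; the parameter is $|B|+k$, and the question is whether there is a set $S\subseteq R$ with $|S|\le k$ such that every vertex of $B$ has a neighbour in $S$. Parameterized problems are regarded as subsets of $\Sigma^*\times\mathbb N$ with $\Sigma=\{0,1\}$, where the first component of an instance is the graph (given by an adjacency matrix) and the second is the parameter. A *polynomial parameter transformation* from $P$ to $Q$ is a function $f:\Sigma^*\times\mathbb N\to\Sigma^*\times\mathbb N$, computable by a Turing machine in time polynomial in $|x|+\kappa$ on input $(x,\kappa)$, such that for some polynomial $p$ and all $(x,\kappa)$ with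 $f(x,\kappa)=(x',\kappa')$ we have $(x,\kappa)\in P\iff(x',\kappa')\in Q$ and $\kappa'\le p(\kappa)$. **Lemma.** There is a polynomial parameter transformation from Red Blue Dominating Set, parameterized by $|B|+k$, to Eternal Vertex Cover, parameterized by solution size. Moreover, it can be chosen such that every instance $(G,k)$ with $b=|B|$ is mapped to an instance $(H,\ell)$ with $\ell=b+k+2$ and $H$ a bipartite graph of diameter at most six (in particular connected), and such that $G$ has a set of at most $k$ red vertices dominating $B$ if and only if $\operatorname{evc}(H)\le\ell$. -/

import Mathlib

/-! ### The eternal vertex cover number -/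

/-- The guards, numbered by `Fin k`, move from the positions `g` to the positions `g'` so as to
defend an attack on the edge `e`: every guard stays where it is or moves to an adjacent vertex, and
at least one guard moves along `e`. -/
def DefendsAttack {V : Type*} (G : SimpleGraph V) {k : ℕ} (e : Sym2 V) (g g' : Fin k → V) : Prop :=
  (∀ i, g' i = g i ∨ G.Adj (g i) (g' i)) ∧ ∃ i, s(g i, g' i) = e

/-- A winning strategy of the defender with `k` guards: it assigns to every finite history of
attacked edges (the most recent one first; `[]` is the beginning of the game) the positions of the
guards, no two of them on one vertex, such that every further attack is defended. -/
def IsWinningStrategy {V : Type*} (G : SimpleGraph V) (k : ℕ)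
    (s : List G.edgeSet → Fin k → V) : Prop :=
  (∀ h, Function.Injective (s h)) ∧
    ∀ (h : List G.edgeSet) (e : G.edgeSet), DefendsAttack G (e : Sym2 V) (s h) (s (e :: h))

/-- `k` guards can protect the graph `G` against every infinite sequence of attacks. -/
def GuardsSuffice {V : Type*} (G : SimpleGraph V) (k : ℕ) : Prop :=
  ∃ s : List G.edgeSet → Fin k → V, IsWinningStrategy G k s

/-- The eternal vertex cover number: the minimum number of guards that can protect `G`. -/
noncomputable def evc {V : Type*} (G : SimpleGraph V) : ℕ :=
  sInf {k | GuardsSuffice G k}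

/-- The minimum in the definition of `evc` is over a nonempty set: one guard on every vertex is
enough, as the two guards on an attacked edge can swap their places. -/
theorem guardsSuffice_card {V : Type*} [Fintype V] (G : SimpleGraph V) :
    GuardsSuffice G (Fintype.card V) := by
  classical
  have hout : ∀ e : G.edgeSet, ∃ p : V × V, s(p.1, p.2) = e.1 := fun e => by
    obtain ⟨⟨a, b⟩, h⟩ := Quot.exists_rep e.1
    exact ⟨(a, b), h⟩
  choose p hp using hout
  let s : List G.edgeSet → Fin (Fintype.card V) → V := fun h =>
    List.rec (fun i => (Fintype.equivFin V).symm i)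
      (fun e _ g i => Equiv.swap (p e).1 (p e).2 (g i)) h
  have hb : ∀ h, Function.Bijective (s h) := by
    intro h
    induction h with
    | nil => exact (Fintype.equivFin V).symm.bijective
    | cons e h ih => exact (Equiv.bijective _).comp ih
  refine ⟨s, fun h => (hb h).1, fun h e => ?_⟩
  have hs : ∀ i, s (e :: h) i = Equiv.swap (p e).1 (p e).2 (s h i) :=
    fun _ => rfl
  have he : s((p e).1, (p e).2) = e.1 := hp e
  have hadj : G.Adj (p e).1 (p e).2 := by
    rw [← SimpleGraph.mem_edgeSet, he]
    exact e.2
  constructor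
  · intro i
    rw [hs]
    rcases eq_or_ne (s h i) (p e).1 with h1 | h1
    · rw [h1, Equiv.swap_apply_left]
      exact Or.inr hadj
    · rcases eq_or_ne (s h i) (p e).2 with h2 | h2
      · rw [h2, Equiv.swap_apply_right]
        exact Or.inr hadj.symm
      · exact Or.inl (Equiv.swap_apply_of_ne_of_ne h1 h2)
  · obtain ⟨i, hi⟩ := (hb h).2 (p e).1
    refine ⟨i, ?_⟩
    rw [hs, hi, Equiv.swap_apply_left, he]

/-! ### Red-blue graphs -/

/-- A bipartite graph `(R ∪ B, E)` with `r` red vertices and `b` blue vertices, given by its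
adjacency relation between red and blue vertices. -/
abbrev RedBlueGraph (r b : ℕ) : Type := Fin r → Fin b → Prop

/-- There is a set of at most `k` red vertices such that every blue vertex has a neighbour in it. -/
def HasRedDominatingSet {r b : ℕ} (G : RedBlueGraph r b) (k : ℕ) : Prop :=
  ∃ S : Finset (Fin r), S.card ≤ k ∧ ∀ u : Fin b, ∃ v ∈ S, G v u

/-! ### Binary encodings of graphs -/

open Classical in
/-- The entries of a 0/1 matrix, row by row. -/
noncomputable def encodeMatrix {m n : ℕ} (M : Fin m → Fin n → Prop) : List Bool :=
  (List.ofFn fun i => List.ofFn fun j => decide (M i j)).flatten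

/-- A graph on `n` vertices as the word `1ⁿ 0` followed by its adjacency matrix. -/
noncomputable def encodeGraph {n : ℕ} (H : SimpleGraph (Fin n)) : List Bool :=
  List.replicate n true ++ false :: encodeMatrix H.Adj

/-- A red-blue graph as the word `1ʳ 0 1ᵇ 0` followed by its red-blue adjacency matrix. -/
noncomputable def encodeRedBlueGraph {r b : ℕ} (G : RedBlueGraph r b) : List Bool :=
  List.replicate r true ++ false :: (List.replicate b true ++ false :: encodeMatrix G)

/-! ### Parameterized problems -/

/-- A parameterized problem over the alphabet `{0, 1}`: a set of pairs `(x, κ)` of a word and a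
parameter. -/
abbrev ParameterizedProblem : Type := Set (List Bool × ℕ)

/-- The word `1^κ 0 x` by which a machine is given the pair `(x, κ)`; its length is
`|x| + κ + 1`. -/
def encodeInstance (I : List Bool × ℕ) : List Bool :=
  List.replicate I.2 true ++ false :: I.1

/-- `f` is a polynomial parameter transformation from `P` to `Q`: it is computable by a Turing
machine in time polynomial in `|x| + κ`, it maps yes-instances to yes-instances and no-instances to
no-instances, and the new parameter is bounded by a polynomial in the old one. -/
def IsPolynomialParameterTransformation (P Q : ParameterizedProblem)
    (f : List Bool × ℕ → List Bool × ℕ) : Prop :=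
  Nonempty (Turing.TM2ComputableInPolyTime encodeInstance encodeInstance f) ∧
  (∀ (x : List Bool) (κ : ℕ), (x, κ) ∈ P ↔ f (x, κ) ∈ Q) ∧
  ∃ p : Polynomial ℕ, ∀ (x : List Bool) (κ : ℕ), (f (x, κ)).2 ≤ p.eval κ

/-- Red Blue Dominating Set parameterized by `|B| + k`: the instance `(G, k)` is the pair
`(G, |B| + k)`. -/
def RedBlueDominatingSetProblem : ParameterizedProblem :=
  {I | ∃ (r b : ℕ) (G : RedBlueGraph r b) (k : ℕ),
    I = (encodeRedBlueGraph G, b + k) ∧ HasRedDominatingSet G k}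

/-- Eternal Vertex Cover parameterized by solution size: given a graph `H` and a positive integer
`l`, is `evc H ≤ l`? -/
def EternalVertexCoverProblem : ParameterizedProblem :=
  {I | ∃ (n : ℕ) (H : SimpleGraph (Fin n)) (l : ℕ),
    0 < l ∧ I = (encodeGraph H, l) ∧ evc H ≤ l}

/-! The reduction adds a blue vertex `none` adjacent to all red vertices and hangs `b + k + 3`
leaves, one more than the number of guards, on each of the `b + 1` blue vertices.

If `S` dominates the blue vertices, then `S` together with all blue vertices is a vertex cover,
since every edge has a blue end, and it is connected through `none`. A connected vertex cover `D`
that has a neighbour outside gives a defence with `|D| + 1` guards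
(`guardsSuffice_of_connected_cover`): they occupy `D` and one outside vertex, and an attack on an
edge leading to an unguarded vertex is met by shifting guards along a path through `D`. Here `|D| +
1 = |S| + b + 2`.

Conversely (`exists_dominating_of_guardsSuffice`), with at most `b + k + 2` guards every blue vertex
always has a free leaf, so it must always be guarded itself. After an attack towards a free leaf of
`none`, a guard stands on that leaf and `b + 1` others on the blue vertices. An attack towards a
free leaf of `u` pulls the guard off `u`, and another guard must step in from a red neighbour or a
leaf of `u`. Reading a leaf of `u` as some red neighbour of `u`, the at most `k` remaining guards
give a dominating set.

Both the diameter bound and this replacement need every blue vertex to have a red neighbour.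
Instances with an isolated blue vertex, which are no-instances, and malformed words go to a complete
bipartite graph with sides of size `κ + 3`, where too few guards cannot even form a vertex cover
(`le_evc_splitGraph`).

For the running time, structured stack programs are compiled to `TM2` machines (`Cmd.Runs.reaches`).
The class `Comp` of word functions is closed under substitution, bounded loops and case distinction;
with numbers in unary this suffices to write down the adjacency matrix (`comp_outputWord`). -/

/-! ### A structured language for stack machines -/

/-- Structured programs over stacks of bits numbered by `ℕ`. `case k p` and `loop k p` pop an
element of stack `k` and continue depending on the result. -/
inductive Cmd : Type
  | skip : Cmd
  | push : ℕ → Bool → Cmd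
  | seq : Cmd → Cmd → Cmd
  | case : ℕ → (Option Bool → Cmd) → Cmd
  | loop : ℕ → (Bool → Cmd) → Cmd

namespace Cmd

open Function Turing

/-- `Runs c S S' t`: the program `c` started on the stacks `S` ends with the stacks `S'` after
`t` steps. -/
inductive Runs : Cmd → (ℕ → List Bool) → (ℕ → List Bool) → ℕ → Prop
  | skip (S) : Runs skip S S 1
  | push (S k b) : Runs (push k b) S (update S k (b :: S k)) 1
  | seq {p q S S₁ S₂ t₁ t₂} : Runs p S S₁ t₁ → Runs q S₁ S₂ t₂ → Runs (seq p q) S S₂ (t₁ + t₂)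
  | case {k p S S₁ t} : Runs (p (S k).head?) (update S k (S k).tail) S₁ t →
      Runs (case k p) S S₁ (1 + t)
  | loopNil {k p S} : S k = [] → Runs (loop k p) S S 1
  | loopCons {k p S S₁ S₂ b w t₁ t₂} : S k = b :: w → Runs (p b) (update S k w) S₁ t₁ →
      Runs (loop k p) S₁ S₂ t₂ → Runs (loop k p) S S₂ (1 + t₁ + t₂)

/-- The labels of the machine code of a program. -/
def Lab : Cmd → Type
  | skip => Unit
  | push _ _ => Unit
  | seq p q => Lab p ⊕ Lab q
  | case _ p => Option (Σ o, Lab (p o))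
  | loop _ p => Option (Σ b, Lab (p b))

/-- The label at which the machine code of a program is entered. -/
def entry : (c : Cmd) → c.Lab
  | skip => ()
  | push _ _ => ()
  | seq p _ => Sum.inl (entry p)
  | case _ _ => none
  | loop _ _ => none

theorem finite_lab : (c : Cmd) → Finite c.Lab
  | skip => inferInstanceAs (Finite Unit)
  | push _ _ => inferInstanceAs (Finite Unit)
  | seq p q =>
    haveI := finite_lab p
    haveI := finite_lab q
    inferInstanceAs (Finite (p.Lab ⊕ q.Lab))
  | case _ p =>
    haveI := fun o => finite_lab (p o)
    inferInstanceAs (Finite (Option (Σ o, (p o).Lab)))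
  | loop _ p =>
    haveI := fun b => finite_lab (p b)
    inferInstanceAs (Finite (Option (Σ b, (p b).Lab)))

/-- All stacks used by a program have numbers below `M`. -/
def UsesBelow (M : ℕ) : Cmd → Prop
  | skip => True
  | push k _ => k < M
  | seq p q => UsesBelow M p ∧ UsesBelow M q
  | case k p => k < M ∧ ∀ o, UsesBelow M (p o)
  | loop k p => k < M ∧ ∀ b, UsesBelow M (p b)

theorem UsesBelow.mono {M N : ℕ} (h : M ≤ N) : ∀ {c : Cmd}, UsesBelow M c → UsesBelow N c
  | skip, _ => trivial
  | push _ _, hc => lt_of_lt_of_le hc h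
  | seq _ _, hc => ⟨hc.1.mono h, hc.2.mono h⟩
  | case _ _, hc => ⟨lt_of_lt_of_le hc.1 h, fun o => (hc.2 o).mono h⟩
  | loop _ _, hc => ⟨lt_of_lt_of_le hc.1 h, fun b => (hc.2 b).mono h⟩

theorem exists_usesBelow : (c : Cmd) → ∃ M, UsesBelow M c
  | skip => ⟨0, trivial⟩
  | push k _ => ⟨k + 1, Nat.lt_succ_self k⟩
  | seq p q => by
    obtain ⟨m, hm⟩ := exists_usesBelow p
    obtain ⟨n, hn⟩ := exists_usesBelow q
    exact ⟨max m n, hm.mono (le_max_left _ _), hn.mono (le_max_right _ _)⟩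
  | case k p => by
    choose m hm using fun o => exists_usesBelow (p o)
    exact ⟨k + 1 + ∑ o, m o, by omega, fun o => (hm o).mono
      ((Finset.single_le_sum (fun _ _ => Nat.zero_le _) (Finset.mem_univ o)).trans (by omega))⟩
  | loop k p => by
    choose m hm using fun b => exists_usesBelow (p b)
    exact ⟨k + 1 + ∑ b, m b, by omega, fun b => (hm b).mono
      ((Finset.single_le_sum (fun _ _ => Nat.zero_le _) (Finset.mem_univ b)).trans (by omega))⟩

/-! ### Compilation of programs into stack machines. -/

section Code

variable {M : ℕ} {L : Type}

/-- The machine code of a program, with its labels embedded by `emb` and the exit label `ex`. -/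
def code [NeZero M] : (c : Cmd) → (c.Lab → L) → L → c.Lab →
    TM2.Stmt (fun _ : Fin M => Bool) L (Option Bool)
  | skip, _, ex, _ => .goto fun _ => ex
  | push k b, _, ex, _ => .push (Fin.ofNat M k) (fun _ => b) (.goto fun _ => ex)
  | seq p q, emb, ex, x => match x with
    | .inl y => code p (fun z => emb (.inl z)) (emb (.inr q.entry)) y
    | .inr y => code q (fun z => emb (.inr z)) ex y
  | case k p, emb, ex, x => match x with
    | none => .pop (Fin.ofNat M k) (fun _ o => o) (.goto fun o => emb (some ⟨o, (p o).entry⟩))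
    | some ⟨o, y⟩ => code (p o) (fun z => emb (some ⟨o, z⟩)) ex y
  | loop k p, emb, ex, x => match x with
    | none => .pop (Fin.ofNat M k) (fun _ o => o) (.goto fun o => match o with
      | none => ex
      | some b => emb (some ⟨b, (p b).entry⟩))
    | some ⟨b, y⟩ => code (p b) (fun z => emb (some ⟨b, z⟩)) (emb none) y

/-- The machine `m` reaches `d` from `c` in exactly `t` steps. -/
def Reaches (m : L → TM2.Stmt (fun _ : Fin M => Bool) L (Option Bool)) (t : ℕ)
    (c d : TM2.Cfg (fun _ : Fin M => Bool) L (Option Bool)) : Prop :=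
  (flip bind (TM2.step m))^[t] (some c) = some d

theorem Reaches.trans {m : L → TM2.Stmt (fun _ : Fin M => Bool) L (Option Bool)} {s t : ℕ}
    {c d e : TM2.Cfg (fun _ : Fin M => Bool) L (Option Bool)}
    (h₁ : Reaches m s c d) (h₂ : Reaches m t d e) : Reaches m (s + t) c e := by
  unfold Reaches at *
  rw [add_comm, Function.iterate_add_apply, h₁, h₂]

theorem Reaches.single {m : L → TM2.Stmt (fun _ : Fin M => Bool) L (Option Bool)} {l : L}
    {q : TM2.Stmt (fun _ : Fin M => Bool) L (Option Bool)} {v : Option Bool}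
    {T : Fin M → List Bool} {d : TM2.Cfg (fun _ : Fin M => Bool) L (Option Bool)}
    (hl : m l = q) (h : TM2.stepAux q v T = d) : Reaches m 1 ⟨some l, v, T⟩ d :=
  congrArg some ((congrArg (fun q => TM2.stepAux q v T) hl).trans h)

theorem update_comp_val [NeZero M] (S : ℕ → List Bool) {k : ℕ} (hk : k < M) (w : List Bool) :
    update (fun i : Fin M => S i) (Fin.ofNat M k) w = fun i : Fin M => update S k w i := by
  funext i
  simp only [update_apply, Fin.ext_iff, Fin.ofNat, Nat.mod_eq_of_lt hk]

/-- Quantifying over the machine, the label embedding and the exit label lets the induction treat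
subprograms as fragments of a larger machine. The internal state `v` is arbitrary because every pop
overwrites it before the following jump reads it. -/
theorem Runs.reaches [NeZero M] {c : Cmd} {S S' : ℕ → List Bool} {t : ℕ} (h : Runs c S S' t) :
    ∀ (m : L → TM2.Stmt (fun _ : Fin M => Bool) L (Option Bool)) (emb : c.Lab → L) (ex : L),
      c.UsesBelow M → (∀ x, m (emb x) = code c emb ex x) → ∀ v, ∃ v',
        Reaches m t ⟨some (emb c.entry), v, fun i => S i⟩ ⟨some ex, v', fun i => S' i⟩ := by
  have hmod : ∀ {k : ℕ}, k < M → ((Fin.ofNat M k : Fin M) : ℕ) = k := fun hk => by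
    simp [Fin.ofNat, Nat.mod_eq_of_lt hk]
  induction h with
  | skip S =>
    intro m emb ex _ hm v
    exact ⟨v, Reaches.single (hm ()) rfl⟩
  | push S k b =>
    intro m emb ex hc hm v
    refine ⟨v, Reaches.single (hm ()) ?_⟩
    simp only [code, TM2.stepAux, update_comp_val S hc, hmod hc]
  | @seq p q S S₁ S₂ t₁ t₂ _ _ ih₁ ih₂ =>
    intro m emb ex hc hm v
    obtain ⟨v₁, h₁⟩ := ih₁ m (fun z => emb (.inl z)) (emb (.inr q.entry)) hc.1
      (fun x => hm (.inl x)) v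
    obtain ⟨v₂, h₂⟩ := ih₂ m (fun z => emb (.inr z)) ex hc.2 (fun x => hm (.inr x)) v₁
    exact ⟨v₂, h₁.trans h₂⟩
  | @case k p S S₁ t _ ih =>
    intro m emb ex hc hm v
    obtain ⟨v₁, h₁⟩ := ih m (fun z => emb (some ⟨_, z⟩)) ex (hc.2 _)
      (fun x => hm (some ⟨_, x⟩)) (S k).head?
    refine ⟨v₁, Reaches.trans (Reaches.single (hm none) ?_) h₁⟩
    simp only [code, TM2.stepAux.eq_3]
    rw [hmod hc.1, update_comp_val S hc.1, TM2.stepAux]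
  | @loopNil k p S hS =>
    intro m emb ex hc hm v
    refine ⟨none, Reaches.single (hm none) ?_⟩
    simp only [code, TM2.stepAux, update_comp_val S hc.1, hmod hc.1, hS, List.head?_nil,
      List.tail_nil]
    congr 2
    funext i
    rw [← hS, update_eq_self]
  | @loopCons k p S S₁ S₂ b w t₁ t₂ hS _ _ ih₁ ih₂ =>
    intro m emb ex hc hm v
    obtain ⟨v₁, h₁⟩ := ih₁ m (fun z => emb (some ⟨b, z⟩)) (emb none) (hc.2 b)
      (fun x => hm (some ⟨b, x⟩)) (some b)
    obtain ⟨v₂, h₂⟩ := ih₂ m emb ex hc hm v₁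
    refine ⟨v₂, Reaches.trans (Reaches.trans (Reaches.single (hm none) ?_) h₁) h₂⟩
    simp only [code, TM2.stepAux, update_comp_val S hc.1, hmod hc.1, hS, List.head?_cons,
      List.tail_cons]

end Code

/-- The stack machine that runs `c` with input stack `2` and output stack `1`. -/
noncomputable def machine (c : Cmd) (M : ℕ) [NeZero M] : FinTM2 :=
  letI : Fintype c.Lab := @Fintype.ofFinite _ c.finite_lab
  { K := Fin M
    k₀ := Fin.ofNat M 2
    k₁ := Fin.ofNat M 1
    Γ := fun _ => Bool
    Λ := Option c.Lab
    main := some c.entry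
    σ := Option Bool
    initialState := none
    m := fun x => match x with
      | none => .load (fun _ => none) .halt
      | some y => code c some none y }

/-- A program that maps the word `e a` on stack `2` to the word `e' (f a)` on stack `1` in
polynomial time yields a polynomial time Turing machine. -/
theorem computableInPolyTime {α β : Type} {e : α → List Bool} {e' : β → List Bool} {f : α → β}
    (c : Cmd) (p : Polynomial ℕ)
    (hc : ∀ a, ∃ t ≤ p.eval (e a).length,
      Runs c (update (fun _ => []) 2 (e a)) (update (fun _ => []) 1 (e' (f a))) t) :
    Nonempty (TM2ComputableInPolyTime e e' f) := by
  obtain ⟨M₀, hM₀⟩ := exists_usesBelow c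
  have hM : c.UsesBelow (M₀ + 3) := hM₀.mono (by omega)
  have hofNat : ∀ k < M₀ + 3, ∀ (i : Fin (M₀ + 3)), i = Fin.ofNat (M₀ + 3) k ↔ (i : ℕ) = k := by
    intro k hk i
    simp [Fin.ext_iff, Fin.ofNat, Nat.mod_eq_of_lt hk]
  refine ⟨{ tm := c.machine (M₀ + 3), inputAlphabet := Equiv.refl Bool,
            outputAlphabet := Equiv.refl Bool, time := p + 1, outputsFun := fun a => ?_ }⟩
  have key : ∃ t ≤ (p + 1).eval (e a).length,
      (flip bind (c.machine (M₀ + 3)).step)^[t]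
        (some (initList (c.machine (M₀ + 3)) (e a))) =
          some (haltList (c.machine (M₀ + 3)) (e' (f a))) := by
    obtain ⟨t, ht, hr⟩ := hc a
    obtain ⟨v, hv⟩ := hr.reaches (M := M₀ + 3) (L := Option c.Lab)
      (c.machine (M₀ + 3)).m some none hM (fun x => rfl) none
    -- The additional step is the one at the exit label: it resets the internal state, as `haltList`
    -- demands, and halts.
    refine ⟨t + 1, by simpa using ht, ?_⟩
    have h := hv.trans (t := 1)
      (e := ⟨none, none, fun i : Fin (M₀ + 3) => update (fun _ => []) 1 (e' (f a)) (i : ℕ)⟩) (Reaches.single rfl rfl)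
    have hi : initList (c.machine (M₀ + 3)) (e a) =
        ⟨some (some c.entry), none, fun i : Fin (M₀ + 3) => update (fun _ => []) 2 (e a) (i : ℕ)⟩ := by
      unfold initList
      congr 1
      funext i
      by_cases hi : i = Fin.ofNat (M₀ + 3) 2
      · have := (hofNat 2 (by omega) i).1 hi
        subst hi
        rw [this]
        simp [machine]
        rfl
      · have := fun h => hi ((hofNat 2 (by omega) i).2 h)
        rw [update_of_ne this]
        exact dif_neg hi
    have ho : haltList (c.machine (M₀ + 3)) (e' (f a)) =
        ⟨none, none, fun i : Fin (M₀ + 3) => update (fun _ => []) 1 (e' (f a)) (i : ℕ)⟩ := by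
      unfold haltList
      congr 1
      funext i
      by_cases hi : i = Fin.ofNat (M₀ + 3) 1
      · have := (hofNat 1 (by omega) i).1 hi
        subst hi
        rw [this]
        simp [machine]
        rfl
      · have := fun h => hi ((hofNat 1 (by omega) i).2 h)
        rw [update_of_ne this]
        exact dif_neg hi
    rw [hi, ho]
    exact h
  have h₁ : ∀ w : List Bool, List.map (Equiv.refl Bool).invFun w = w := fun w => List.map_id w
  refine { steps := key.choose, evals_in_steps := ?_, steps_le_m := key.choose_spec.1 }
  refine Eq.trans ?_ (key.choose_spec.2.trans ?_)
  · exact congrArg (fun w => (flip bind (c.machine (M₀ + 3)).step)^[key.choose]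
      (some (initList (c.machine (M₀ + 3)) w))) (h₁ (e a))
  · exact congrArg (fun w => some (haltList (c.machine (M₀ + 3)) w)) (h₁ (e' (f a))).symm

end Cmd

/-! ### Basic programs: clearing, moving, copying and inspecting stacks. -/

namespace Cmd

open Function

theorem Runs.congr {c : Cmd} {S S' S'' : ℕ → List Bool} {t t' : ℕ} (h : Runs c S S' t)
    (hS : S' = S'') (ht : t = t') : Runs c S S'' t' := hS ▸ ht ▸ h

/-- Empty stack `k`. -/
def clear (k : ℕ) : Cmd := loop k fun _ => skip

/-- Move stack `n` to stack `z`, reversing it. -/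
def move (n z : ℕ) : Cmd := loop n fun b => push z b

/-- Put a copy of stack `n`, with `f` applied to its bits, on top of stack `o`. -/
def copy (f : Bool → Bool) (n o : ℕ) : Cmd :=
  seq (move n 0) (loop 0 fun b => seq (push n b) (push o (f b)))

/-- Move as many elements of stack `n` to stack `0` as there are on stack `z`. -/
def dropAlong (n z : ℕ) : Cmd :=
  loop z fun _ => case n fun o => o.elim skip fun b => push 0 b

theorem update_update_nil {S : ℕ → List Bool} {N o : ℕ} (hN : S N = []) (ho : o ≠ N)
    (v w : List Bool) : update (update (update S N v) o w) N [] = update S o w := by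
  rw [update_comm ho, update_idem, ← hN, update_eq_self]

theorem runs_clear (k : ℕ) (S : ℕ → List Bool) :
    Runs (clear k) S (update S k []) (2 * (S k).length + 1) := by
  generalize hw : S k = w
  induction w generalizing S with
  | nil => exact (Runs.loopNil hw).congr (by rw [← hw, update_eq_self]) rfl
  | cons b w ih =>
    exact (Runs.loopCons hw (Runs.skip _) (ih _ (update_self ..))).congr (by simp)
      (by simp only [List.length_cons]; ring)

theorem runs_move {n z : ℕ} (h : n ≠ z) (S : ℕ → List Bool) :
    Runs (move n z) S (update (update S n []) z ((S n).reverse ++ S z))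
      (2 * (S n).length + 1) := by
  generalize hw : S n = w
  induction w generalizing S with
  | nil =>
    refine (Runs.loopNil hw).congr ?_ rfl
    funext i
    simp only [update_apply]
    split_ifs <;> simp_all
  | cons b w ih =>
    refine (Runs.loopCons hw (Runs.push _ _ _) (ih _ ?_)).congr ?_
      (by simp only [List.length_cons]; ring)
    · simp [update_apply, h]
    · funext i
      simp only [update_apply]
      split_ifs <;> simp_all

theorem runs_copyBack {n o : ℕ} (f : Bool → Bool) (hn : n ≠ 0) (ho : o ≠ 0) (hno : n ≠ o)
    (S : ℕ → List Bool) :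
    Runs (loop 0 fun b => seq (push n b) (push o (f b))) S
      (update (update (update S 0 []) n ((S 0).reverse ++ S n)) o
        (((S 0).map f).reverse ++ S o)) (3 * (S 0).length + 1) := by
  generalize hw : S 0 = w
  induction w generalizing S with
  | nil =>
    refine (Runs.loopNil hw).congr ?_ rfl
    funext i
    simp only [update_apply]
    split_ifs <;> simp_all
  | cons b w ih =>
    refine (Runs.loopCons hw (Runs.seq (Runs.push _ _ _) (Runs.push _ _ _)) (ih _ ?_)).congr ?_
      (by simp only [List.length_cons]; ring)
    · simp [update_apply, hn.symm, ho.symm]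
    · funext i
      simp only [update_apply]
      split_ifs <;> simp_all

theorem runs_copy {n o : ℕ} (f : Bool → Bool) (hn : n ≠ 0) (ho : o ≠ 0) (hno : n ≠ o)
    (S : ℕ → List Bool) (h0 : S 0 = []) :
    Runs (copy f n o) S (update S o ((S n).map f ++ S o)) (5 * (S n).length + 2) := by
  refine (Runs.seq (runs_move hn S) (runs_copyBack f hn ho hno _)).congr ?_ ?_
  · funext i
    simp only [update_apply]
    split_ifs <;> simp_all
  · simp [h0]; ring

/-- Once stack `n` is exhausted the remaining rounds do nothing, in agreement with `take` and `drop`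
beyond the end of a list. -/
theorem runs_dropAlong {n z : ℕ} (hn : n ≠ 0) (hz : z ≠ 0) (hnz : n ≠ z) (S : ℕ → List Bool) :
    ∃ t ≤ 3 * (S z).length + 1, Runs (dropAlong n z) S
      (update (update (update S z []) n ((S n).drop (S z).length)) 0
        (((S n).take (S z).length).reverse ++ S 0)) t := by
  generalize hw : S z = w
  induction w generalizing S with
  | nil =>
    refine ⟨1, by simp, (Runs.loopNil hw).congr ?_ rfl⟩
    funext i
    simp only [update_apply]
    split_ifs <;> simp_all
  | cons b w ih =>
    rcases hl : S n with _ | ⟨d, l⟩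
    · obtain ⟨t, ht, hr⟩ := ih (update (update S z w) n []) (by simp [hnz.symm])
      refine ⟨_, ?_, (Runs.loopCons hw (Runs.case (t := 1) (S₁ := update (update S z w) n [])
        ?_) hr).congr ?_ rfl⟩
      · simp only [List.length_cons]; omega
      · have h1 : update S z w n = [] := by simp [hnz, hl]
        rw [h1]
        exact Runs.skip _
      · funext i
        simp only [update_apply]
        split_ifs <;> simp_all
    · obtain ⟨t, ht, hr⟩ := ih (update (update (update S z w) n l) 0 (d :: S 0))
        (by simp [hnz.symm, hz])
      refine ⟨_, ?_, (Runs.loopCons hw (Runs.case (t := 1)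
        (S₁ := update (update (update S z w) n l) 0 (d :: S 0)) ?_) hr).congr ?_ rfl⟩
      · simp only [List.length_cons]; omega
      · have h1 : update S z w n = d :: l := by simp [hnz, hl]
        rw [h1]
        refine (Runs.push _ _ _).congr ?_ rfl
        simp [hn.symm, hz.symm]
      · funext i
        simp only [update_apply]
        split_ifs <;> simp_all

/-- Pop an element of stack `n` but put it back, refill stack `n` from stack `0`, and continue
with `p` if the element is `true` and with `q` otherwise. -/
def restoreAndBranch (n : ℕ) (p q : Cmd) : Cmd :=
  case n fun o => seq (o.elim skip fun b => push n b)
    (seq (move 0 n) (if o = some true then p else q))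

/-- The removed prefix lies reversed on stack `0`; moving it back reverses it again, so a test
leaves no trace and the chosen branch starts from the original stacks. -/
theorem update_restore {S : ℕ → List Bool} {N n : ℕ} (hN : S N = []) (h0 : S 0 = []) (hn : n ≠ 0)
    (hN0 : N ≠ 0) (v : List Bool) (k : ℕ) {w : List Bool} (hw : S n = w) :
    update (update (update (update (update (update S N v) N []) n (w.drop k)) 0
      ((w.take k).reverse ++ update S N v 0)) 0 []) n
        (((w.take k).reverse ++ update S N v 0).reverse ++ w.drop k) = S := by
  have h₁ : update S N [] = S := by rw [← hN, update_eq_self]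
  have h₂ : update S 0 [] = S := by rw [← h0, update_eq_self]
  rw [update_of_ne hN0.symm, h0, update_idem, update_idem, List.append_nil, List.reverse_reverse,
    List.take_append_drop, update_comm hn, update_idem, h₁, h₂, ← hw, update_eq_self]

theorem runs_restoreAndBranch {n : ℕ} (hn : n ≠ 0) {p q : Cmd} {S S' : ℕ → List Bool} {t : ℕ}
    (h : Runs (if (S n).head? = some true then p else q)
      (update (update S 0 []) n ((S 0).reverse ++ S n)) S' t) :
    Runs (restoreAndBranch n p q) S S' (2 * (S 0).length + t + 3) := by
  have h1 : Runs ((S n).head?.elim skip fun b => push n b) (update S n (S n).tail) S 1 := by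
    rcases hl : S n with _ | ⟨d, l⟩
    · exact (Runs.skip _).congr (by rw [List.tail_nil, ← hl, update_eq_self]) rfl
    · refine (Runs.push _ _ _).congr ?_ rfl
      simp only [List.tail_cons, update_self, update_idem]
      rw [← hl, update_eq_self]
  exact (Runs.case (Runs.seq h1 (Runs.seq (runs_move hn.symm S) h))).congr rfl (by ring)

end Cmd

/-! ### A calculus of word functions computable in polynomial time -/

open Function Cmd

/-- `F` is computable in polynomial time from the words `Γ i`: for every assignment of stacks to
these words there is a program that pushes the word `F a` on the stack `o`, leaves all other
stacks unchanged, and uses, besides stack `0` for scratch, only the stacks from `N` on. -/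
def Comp {ι α : Type} (Γ : ι → α → List Bool) (F : α → List Bool) : Prop :=
  ∃ P : Polynomial ℕ, ∀ (ρ : ι → ℕ) (o N : ℕ),
    (∀ i, ρ i ≠ 0 ∧ ρ i < N ∧ ρ i ≠ o) → o ≠ 0 → o < N → ∃ c : Cmd,
      ∀ (a : α) (S : ℕ → List Bool) (m : ℕ),
        (∀ i, S (ρ i) = Γ i a) → (∀ i, (Γ i a).length ≤ m) → S 0 = [] →
        (∀ j, N ≤ j → S j = []) →
          (F a).length ≤ P.eval m ∧ ∃ t ≤ P.eval m, Runs c S (update S o (F a ++ S o)) t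

/-- The words `Γ` together with the word `G`. -/
def withWord {ι α : Type} (Γ : ι → α → List Bool) (G : α → List Bool) :
    Option ι → α → List Bool :=
  fun i a => i.elim (G a) fun i => Γ i a

/-- The words `Γ` together with a number in unary. -/
def withNat {ι α : Type} (Γ : ι → α → List Bool) : Option ι → α × ℕ → List Bool :=
  withWord (fun i p => Γ i p.1) fun p => List.replicate p.2 true

namespace Comp

variable {ι ι' α α' : Type} {Γ : ι → α → List Bool} {Γ' : ι' → α' → List Bool}
  {F F' G : α → List Bool}

theorem nil : Comp Γ fun _ => [] :=
  ⟨1, fun _ _ _ _ _ _ => ⟨Cmd.skip, fun a S m _ _ _ _ =>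
    ⟨by simp, 1, by simp, (Runs.skip S).congr (by simp) rfl⟩⟩⟩

theorem bit (b : Bool) : Comp Γ fun _ => [b] :=
  ⟨1, fun _ o _ _ _ _ => ⟨Cmd.push o b, fun a S m _ _ _ _ =>
    ⟨by simp, 1, by simp, Runs.push S o b⟩⟩⟩

theorem var (i : ι) : Comp Γ (Γ i) := by
  refine ⟨5 * Polynomial.X + 2, fun ρ o N hρ ho _ => ⟨Cmd.copy id (ρ i) o,
    fun a S m hS hm h0 _ => ⟨?_, _, ?_,
      (runs_copy id (hρ i).1 ho (hρ i).2.2 S h0).congr (by simp [hS]) rfl⟩⟩⟩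
  · have := hm i
    simp
    omega
  · have := hm i
    simp [hS]
    omega

theorem append (hF : Comp Γ F) (hG : Comp Γ G) : Comp Γ fun a => F a ++ G a := by
  obtain ⟨P, hP⟩ := hF
  obtain ⟨Q, hQ⟩ := hG
  refine ⟨P + Q, fun ρ o N hρ ho hN => ?_⟩
  obtain ⟨p, hp⟩ := hP ρ o N hρ ho hN
  obtain ⟨q, hq⟩ := hQ ρ o N hρ ho hN
  -- Stacks grow at the front, so the right-hand word is pushed first.
  refine ⟨Cmd.seq q p, fun a S m hS hm h0 hSN => ?_⟩
  obtain ⟨hl, t, ht, hr⟩ := hq a S m hS hm h0 hSN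
  obtain ⟨hl', t', ht', hr'⟩ := hp a (update S o (G a ++ S o)) m
    (fun i => by rw [update_of_ne (hρ i).2.2, hS]) hm (by rw [update_of_ne ho.symm, h0])
    (fun j hj => by rw [update_of_ne (by omega), hSN j hj])
  refine ⟨by simp; omega, t + t', by simp; omega, (Runs.seq hr hr').congr (by simp) rfl⟩

/-- The intermediate word lives on stack `N`, which is cleared at the end; the inner program works
from `N + 1` on. Its inputs have length at most `m + P m`, whence the composition of polynomials. -/
theorem bind (hG : Comp Γ G) (hF : Comp (withWord Γ G) F) : Comp Γ F := by
  obtain ⟨P, hP⟩ := hG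
  obtain ⟨Q, hQ⟩ := hF
  refine ⟨P + Q.comp (Polynomial.X + P) + (2 * P + 1), fun ρ o N hρ ho hN => ?_⟩
  obtain ⟨p, hp⟩ := hP ρ N (N + 1) (fun i => by have := hρ i; omega) (by omega) (by omega)
  obtain ⟨q, hq⟩ := hQ (fun i => i.elim N ρ) o (N + 1)
    (fun i => by
      rcases i with _ | i
      · simp; omega
      · have := hρ i; simp; omega) ho (by omega)
  refine ⟨Cmd.seq p (Cmd.seq q (Cmd.clear N)), fun a S m hS hm h0 hSN => ?_⟩
  obtain ⟨hl, t, ht, hr⟩ := hp a S m hS hm h0 (fun j hj => hSN j (by omega))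
  rw [hSN N le_rfl, List.append_nil] at hr
  obtain ⟨hl', t', ht', hr'⟩ := hq a (update S N (G a)) (m + P.eval m)
    (fun i => by
      rcases i with _ | i
      · simp [withWord]
      · have := hρ i
        simp only [Option.elim_some, withWord]
        rw [update_of_ne (by omega), hS])
    (fun i => by
      rcases i with _ | i
      · simp [withWord]; omega
      · have := hm i
        simp [withWord]; omega)
    (by rw [update_of_ne (by omega), h0])
    (fun j hj => by rw [update_of_ne (by omega), hSN j (by omega)])
  refine ⟨?_, _, ?_, (Runs.seq hr (Runs.seq hr' (runs_clear N _))).congr ?_ rfl⟩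
  · simp [Polynomial.eval_comp]; omega
  · rw [update_of_ne (by omega), update_self]
    simp [Polynomial.eval_comp]; omega
  · rw [update_of_ne (by omega : o ≠ N), update_update_nil (hSN N le_rfl) (by omega)]

/-- A unary copy of the word serves as counter on stack `N`. Popping before each round makes the
index run downwards to `0`, and since output is pushed in front, the blocks end up in increasing
order. -/
theorem loop {F : α × ℕ → List Bool} (i : ι) (hF : Comp (withNat Γ) F) :
    Comp Γ fun a => (List.range (Γ i a).length).flatMap fun k => F (a, k) := by
  obtain ⟨P, hP⟩ := hF
  refine ⟨Polynomial.X * (P + 1) + (5 * Polynomial.X + 3), fun ρ o N hρ ho hN => ?_⟩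
  obtain ⟨p, hp⟩ := hP (fun i => i.elim N ρ) o (N + 1)
    (fun i => by
      rcases i with _ | i
      · simp; omega
      · have := hρ i; simp; omega) ho (by omega)
  refine ⟨Cmd.seq (Cmd.copy (fun _ => true) (ρ i) N) (Cmd.loop N fun _ => p),
    fun a S m hS hm h0 hSN => ?_⟩
  have key : ∀ k ≤ m, ∀ S : ℕ → List Bool, (∀ i, S (ρ i) = Γ i a) → S 0 = [] →
      (∀ j, N + 1 ≤ j → S j = []) → S N = List.replicate k true →
      ((List.range k).flatMap fun k => F (a, k)).length ≤ k * P.eval m ∧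
      ∃ t ≤ k * (P.eval m + 1) + 1, Runs (Cmd.loop N fun _ => p) S
        (update (update S N []) o (((List.range k).flatMap fun k => F (a, k)) ++ S o)) t := by
    intro k
    induction k with
    | zero =>
      intro _ S hS h0 hSN hk
      refine ⟨by simp, 1, by simp, (Runs.loopNil hk).congr ?_ rfl⟩
      have hk' : S N = [] := hk
      funext i
      simp only [update_apply]
      split_ifs <;> simp_all
    | succ k ih =>
      intro hkm S hS h0 hSN hk
      obtain ⟨hl, t, ht, hr⟩ := hp (a, k) (update S N (List.replicate k true)) m
        (fun i => by
          rcases i with _ | i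
          · simp [withNat, withWord]
          · have := hρ i
            simp only [Option.elim_some, withWord, withNat]
            rw [update_of_ne (by omega), hS])
        (fun i => by
          rcases i with _ | i
          · simp [withNat, withWord]; omega
          · exact hm i)
        (by rw [update_of_ne (by omega), h0])
        (fun j hj => by rw [update_of_ne (by omega), hSN j (by omega)])
      rw [update_of_ne (by omega : o ≠ N)] at hr
      obtain ⟨hl', t', ht', hr'⟩ := ih (by omega)
        (update (update S N (List.replicate k true)) o (F (a, k) ++ S o))
        (fun i => by have := hρ i; rw [update_of_ne (by omega), update_of_ne (by omega), hS])
        (by rw [update_of_ne (by omega), update_of_ne (by omega), h0])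
        (fun j hj => by rw [update_of_ne (by omega), update_of_ne (by omega), hSN j hj])
        (by rw [update_of_ne (by omega), update_self])
      rw [List.replicate_succ] at hk
      refine ⟨?_, _, ?_, (Runs.loopCons hk hr hr').congr ?_ rfl⟩
      · rw [List.range_succ, List.flatMap_append, List.length_append]
        simp only [List.flatMap_cons, List.flatMap_nil, List.append_nil]
        rw [add_mul]
        omega
      · rw [add_mul k]
        omega
      · rw [List.range_succ, List.flatMap_append]
        funext i
        simp only [update_apply]
        split_ifs <;> simp_all
  have hlen := hm i
  obtain ⟨hl, t, ht, hr⟩ := key (Γ i a).length hlen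
    (update S N (List.replicate (Γ i a).length true))
    (fun i => by have := hρ i; rw [update_of_ne (by omega), hS])
    (by rw [update_of_ne (by omega), h0])
    (fun j hj => by rw [update_of_ne (by omega), hSN j (by omega)]) (by rw [update_self])
  have hc := runs_copy (fun _ => true) (hρ i).1 (by omega : N ≠ 0) (by have := hρ i; omega) S h0
  rw [hSN N le_rfl, hS, List.append_nil, List.map_const'] at hc
  refine ⟨?_, _, ?_, (Runs.seq hc hr).congr ?_ rfl⟩
  · have := Nat.mul_le_mul_right (P.eval m) hlen
    simp only [Polynomial.eval_add, Polynomial.eval_mul, Polynomial.eval_X, Polynomial.eval_one,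
      Polynomial.eval_ofNat, mul_add]
    omega
  · have := Nat.mul_le_mul_right (P.eval m + 1) hlen
    simp; omega
  · rw [update_of_ne (by omega : o ≠ N), update_idem, ← hSN N le_rfl, update_eq_self]

/-- This is the only source of branching in the calculus: the length of one word indexes a bit of
another. The bit is exposed by dropping along a copy of the index word, and everything is restored
before branching. -/
theorem iteVar (i j : ι) (hF : Comp Γ F) (hF' : Comp Γ F') :
    Comp Γ fun a => if (Γ i a)[(Γ j a).length]? = some true then F a else F' a := by
  obtain ⟨P, hP⟩ := hF
  obtain ⟨Q, hQ⟩ := hF'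
  refine ⟨P + Q + (10 * Polynomial.X + 6), fun ρ o N hρ ho hN => ?_⟩
  obtain ⟨p, hp⟩ := hP ρ o N hρ ho hN
  obtain ⟨q, hq⟩ := hQ ρ o N hρ ho hN
  refine ⟨Cmd.seq (Cmd.copy id (ρ j) N) (Cmd.seq (Cmd.dropAlong (ρ i) N)
    (Cmd.restoreAndBranch (ρ i) p q)), fun a S m hS hm h0 hSN => ?_⟩
  obtain ⟨hl, t, ht, hr⟩ := hp a S m hS hm h0 hSN
  obtain ⟨hl', t', ht', hr'⟩ := hq a S m hS hm h0 hSN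
  have hi := hρ i
  have hj := hρ j
  have hmi := hm i
  have hmj := hm j
  have hc := runs_copy id hj.1 (by omega : N ≠ 0) (by omega) S h0
  rw [hSN N le_rfl, hS, List.append_nil, List.map_id] at hc
  obtain ⟨t₁, ht₁, hd⟩ := runs_dropAlong hi.1 (by omega : N ≠ 0) (by omega)
    (update S N (Γ j a))
  simp only [update_self, update_of_ne (by omega : ρ i ≠ N), hS] at ht₁ hd
  have hlen : (List.take (Γ j a).length (Γ i a)).length ≤ (Γ j a).length := by simp
  have key : ∃ t₂ ≤ P.eval m + Q.eval m, Runs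
      (if (Γ i a)[(Γ j a).length]? = some true then p else q) S
      (update S o ((if (Γ i a)[(Γ j a).length]? = some true then F a else F' a) ++ S o)) t₂ := by
    split_ifs
    · exact ⟨t, by omega, hr⟩
    · exact ⟨t', by omega, hr'⟩
  obtain ⟨t₂, ht₂, hb⟩ := key
  refine ⟨?_, _, ?_, Runs.seq hc (Runs.seq hd (runs_restoreAndBranch hi.1 (t := t₂) ?_))⟩
  · simp only [Polynomial.eval_add, Polynomial.eval_mul, Polynomial.eval_X]
    split_ifs <;> omega
  · simp only [Polynomial.eval_add, Polynomial.eval_mul, Polynomial.eval_X, update_self,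
      List.length_append, List.length_reverse, Polynomial.eval_ofNat,
      update_of_ne (by omega : (0 : ℕ) ≠ N), h0, List.length_nil]
    omega
  · have hhead : ∀ T : ℕ → List Bool, (update (update T (ρ i) (List.drop (Γ j a).length (Γ i a))) 0
        ((List.take (Γ j a).length (Γ i a)).reverse ++ (update S N (Γ j a)) 0)) (ρ i) =
          List.drop (Γ j a).length (Γ i a) := fun T => by
      rw [update_of_ne hi.1, update_self]
    rw [hhead, List.head?_drop]
    rw [update_self, update_restore (hSN N le_rfl) h0 hi.1 (by omega) _ _ (hS i)]
    exact hb

/-- The same program works on relabelled stacks, because computability is uniform in the assignment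
of stacks. -/
theorem subst (hF : Comp Γ F) (f : ι → ι') (g : α' → α)
    (h : ∀ i a, Γ' (f i) a = Γ i (g a)) : Comp Γ' fun a => F (g a) := by
  obtain ⟨P, hP⟩ := hF
  refine ⟨P, fun ρ o N hρ ho hN => ?_⟩
  obtain ⟨c, hc⟩ := hP (fun i => ρ (f i)) o N (fun i => hρ (f i)) ho hN
  exact ⟨c, fun a S m hS hm h0 hSN => hc (g a) S m (fun i => by rw [hS, h])
    (fun i => by rw [← h]; exact hm _) h0 hSN⟩

theorem weaken (hF : Comp Γ F) (G : α → List Bool) : Comp (withWord Γ G) F :=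
  hF.subst some id fun _ _ => rfl

theorem up (hF : Comp Γ F) : Comp (withNat Γ) fun p => F p.1 :=
  hF.subst some Prod.fst fun _ _ => rfl

end Comp

theorem Comp.computableInPolyTime {α β : Type} {e : α → List Bool} {e' : β → List Bool}
    {f : α → β} (h : Comp (fun _ : Unit => e) fun a => e' (f a)) :
    Nonempty (Turing.TM2ComputableInPolyTime e e' f) := by
  obtain ⟨P, hP⟩ := h
  obtain ⟨c, hc⟩ := hP (fun _ => 2) 1 3 (by simp) (by simp) (by simp)
  refine Cmd.computableInPolyTime (Cmd.seq c (Cmd.clear 2)) (P + (2 * Polynomial.X + 1))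
    fun a => ?_
  obtain ⟨-, t, ht, hr⟩ := hc a (update (fun _ => []) 2 (e a)) (e a).length (by simp)
    (fun _ => le_rfl) (by simp) (fun j hj => by rw [update_of_ne (by omega)])
  refine ⟨_, ?_, (Runs.seq hr (runs_clear 2 _)).congr ?_ rfl⟩
  · simp; omega
  · funext i
    simp only [update_apply]
    split_ifs <;> simp_all

/-- The number `n a` is computable in unary. -/
def CompNat {ι α : Type} (Γ : ι → α → List Bool) (n : α → ℕ) : Prop :=
  Comp Γ fun a => List.replicate (n a) true

open Classical in
/-- The predicate `P` is decidable in polynomial time. -/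
def CompPred {ι α : Type} (Γ : ι → α → List Bool) (P : α → Prop) : Prop :=
  Comp Γ fun a => if P a then [true] else []

/-- The number of leading `true`s of a word. -/
def leadingOnes (w : List Bool) : ℕ := (w.takeWhile id).length

/-! ### Unary arithmetic, predicates and bounded quantifiers. -/

section Calculus

variable {ι ι' α : Type} {Γ : ι → α → List Bool} {F F' : α → List Bool} {n m : α → ℕ}
  {P Q : α → Prop}

theorem CompNat.up (h : CompNat Γ n) : CompNat (withNat Γ) fun p => n p.1 := Comp.up h

theorem CompPred.up (h : CompPred Γ P) : CompPred (withNat Γ) fun p => P p.1 := Comp.up h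

theorem CompPred.congr (h : CompPred Γ P) (hPQ : ∀ a, Q a ↔ P a) : CompPred Γ Q := by
  rwa [show Q = P from funext fun a => propext (hPQ a)]

theorem CompNat.snd : CompNat (withNat Γ) fun p => p.2 := Comp.var (Γ := withNat Γ) none

theorem Comp.flatMap_range {F : α × ℕ → List Bool} (hn : CompNat Γ n) (hF : Comp (withNat Γ) F) :
    Comp Γ fun a => (List.range (n a)).flatMap fun i => F (a, i) := by
  have h : Comp (withNat (withWord Γ fun a => List.replicate (n a) true)) F :=
    hF.subst (Option.map some) id fun i _ => by cases i <;> rfl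
  have h' := Comp.loop none h
  simp only [withWord, Option.elim_none, List.length_replicate] at h'
  exact Comp.bind hn h'

theorem CompPred.getElem? (hF : Comp Γ F) (hn : CompNat Γ n) :
    CompPred Γ fun a => (F a)[n a]? = some true := by
  refine Comp.bind hF (Comp.bind (hn.weaken F) ?_)
  have h := Comp.iteVar (Γ := withWord (withWord Γ F) fun a => List.replicate (n a) true)
    (some none) none (Comp.bit true) Comp.nil
  simp only [withWord, Option.elim_none, Option.elim_some, List.length_replicate] at h
  convert h

open Classical in
theorem Comp.ite (hP : CompPred Γ P) (hF : Comp Γ F) (hF' : Comp Γ F') :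
    Comp Γ fun a => if P a then F a else F' a := by
  -- The bound empty word acts as the index `0`, so the test inspects the first bit of the word for
  -- `P`.
  refine Comp.bind hP (Comp.bind Comp.nil ?_)
  have h := Comp.iteVar (Γ := withWord (withWord Γ fun a => if P a then [true] else []) fun _ => [])
    (some none) none ((hF.weaken _).weaken _) ((hF'.weaken _).weaken _)
  convert h using 3 with a
  by_cases h : P a <;> simp [withWord, h]

theorem CompPred.and (hP : CompPred Γ P) (hQ : CompPred Γ Q) : CompPred Γ fun a => P a ∧ Q a := by
  have h := Comp.ite hP hQ Comp.nil
  unfold CompPred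
  convert h using 2 with a
  by_cases h₁ : P a <;> by_cases h₂ : Q a <;> simp [h₁, h₂]

theorem CompPred.or (hP : CompPred Γ P) (hQ : CompPred Γ Q) : CompPred Γ fun a => P a ∨ Q a := by
  have h := Comp.ite hP (Comp.bit true) hQ
  unfold CompPred
  convert h using 2 with a
  by_cases h₁ : P a <;> by_cases h₂ : Q a <;> simp [h₁, h₂]

theorem CompPred.not (hP : CompPred Γ P) : CompPred Γ fun a => ¬ P a := by
  have h := Comp.ite hP Comp.nil (Comp.bit true)
  unfold CompPred
  convert h using 2 with a
  by_cases h₁ : P a <;> simp [h₁]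

theorem CompNat.const (k : ℕ) : CompNat Γ fun _ => k := by
  induction k with
  | zero => exact Comp.nil
  | succ k ih => exact (Comp.bit true).append ih

theorem CompNat.add (hn : CompNat Γ n) (hm : CompNat Γ m) : CompNat Γ fun a => n a + m a := by
  unfold CompNat
  simp only [List.replicate_add]
  exact Comp.append hn hm

theorem Comp.length (hF : Comp Γ F) : CompNat Γ fun a => (F a).length := by
  have h := Comp.loop (Γ := withWord Γ F) none (Comp.bit true)
  refine Comp.bind hF ?_
  convert h using 2 with a
  refine (List.eq_replicate_iff.2 ⟨?_, ?_⟩).symm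
  · simp [withWord]
  · simp

theorem CompNat.mul (hn : CompNat Γ n) (hm : CompNat Γ m) : CompNat Γ fun a => n a * m a := by
  have h := Comp.flatMap_range hn (F := fun p => List.replicate (m p.1) true) hm.up
  unfold CompNat
  convert h using 2 with a
  refine (List.eq_replicate_iff.2 ⟨?_, ?_⟩).symm
  · simp
  · simp

/-- In unary, `n < m` means that the word of `m` has a letter at index `n`. -/
theorem CompPred.lt (hn : CompNat Γ n) (hm : CompNat Γ m) : CompPred Γ fun a => n a < m a :=
  (CompPred.getElem? hm hn).congr fun a => by simp [List.getElem?_replicate]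

theorem CompPred.le (hn : CompNat Γ n) (hm : CompNat Γ m) : CompPred Γ fun a => n a ≤ m a :=
  (CompPred.lt hn (hm.add (CompNat.const 1))).congr fun a => by omega

theorem CompPred.eq (hn : CompNat Γ n) (hm : CompNat Γ m) : CompPred Γ fun a => n a = m a :=
  ((CompPred.le hn hm).and (CompPred.le hm hn)).congr fun a => by omega

/-- Concatenating the truth words of all `i` gives a word of `true`s that is nonempty exactly when
there is a witness. -/
theorem CompPred.exists_lt {P : α × ℕ → Prop} (hn : CompNat Γ n) (hP : CompPred (withNat Γ) P) :
    CompPred Γ fun a => ∃ i < n a, P (a, i) := by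
  refine (CompPred.getElem? (Comp.flatMap_range hn hP) (CompNat.const 0)).congr fun a => ?_
  set w := (List.range (n a)).flatMap _ with hw
  have hmem : ∀ b ∈ w, b = true := fun b hb => by
    simp only [hw, List.mem_flatMap, List.mem_range] at hb
    obtain ⟨i, -, hi⟩ := hb
    split_ifs at hi <;> simp_all
  have hiff : (∃ i < n a, P (a, i)) ↔ true ∈ w := by
    simp only [hw, List.mem_flatMap, List.mem_range]
    refine exists_congr fun i => and_congr_right fun _ => ?_
    by_cases h : P (a, i) <;> simp [h]
  rw [hiff]
  rcases w with _ | ⟨b, w⟩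
  · simp
  · simp [hmem b (by simp)]

theorem CompPred.forall_lt {P : α × ℕ → Prop} (hn : CompNat Γ n) (hP : CompPred (withNat Γ) P) :
    CompPred Γ fun a => ∀ i < n a, P (a, i) :=
  (CompPred.exists_lt hn hP.not).not.congr fun a => by push Not; rfl

open Classical in
theorem Comp.decide (hP : CompPred Γ P) : Comp Γ fun a => [Decidable.decide (P a)] := by
  have h := Comp.ite hP (Comp.bit true) (Comp.bit false)
  convert h using 2 with a
  by_cases h₁ : P a <;> simp [h₁]

/-- Expresses `drop` as a bounded loop with a test, the form which the calculus can compute. -/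
theorem drop_eq_flatMap (w : List Bool) (k : ℕ) :
    w.drop k = (List.range w.length).flatMap fun i =>
      if k ≤ i then [decide (w[i]? = some true)] else [] := by
  induction w generalizing k with
  | nil => simp
  | cons b w ih =>
    rw [List.length_cons, List.range_succ_eq_map, List.flatMap_cons, List.flatMap_map]
    rcases k with _ | k
    · simpa using ih 0
    · simpa using ih k

theorem replicate_leadingOnes (w : List Bool) :
    List.replicate (leadingOnes w) true = (List.range w.length).flatMap fun i =>
      if ∀ j < i + 1, w[j]? = some true then [true] else [] := by
  induction w with
  | nil => rfl
  | cons b w ih =>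
    rw [List.length_cons, List.range_succ_eq_map, List.flatMap_cons, List.flatMap_map]
    cases b
    · simp only [leadingOnes, List.takeWhile_cons, id]
      simpa using fun x _ => ⟨0, by omega, by simp⟩
    · unfold leadingOnes at ih ⊢
      simp only [List.takeWhile_cons, id, if_true, List.length_cons, List.replicate_succ, ih]
      have h : ∀ i, (∀ j ≤ i + 1, (true :: w)[j]? = some true) ↔ ∀ j ≤ i, w[j]? = some true :=
        fun i => ⟨fun h j hj => by simpa using h (j + 1) (by omega), fun h j hj => by
          rcases j with _ | j
          · rfl
          · simpa using h j (by omega)⟩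
      simp [h]

theorem Comp.drop (hF : Comp Γ F) (hn : CompNat Γ n) : Comp Γ fun a => (F a).drop (n a) := by
  have h := Comp.flatMap_range hF.length (Comp.ite (CompPred.le hn.up CompNat.snd)
    (Comp.decide (CompPred.getElem? hF.up CompNat.snd)) Comp.nil)
  convert h using 2 with a
  convert drop_eq_flatMap _ _

theorem Comp.leadingOnes (hF : Comp Γ F) : CompNat Γ fun a => leadingOnes (F a) := by
  have h := Comp.flatMap_range hF.length (Comp.ite (CompPred.forall_lt
    (CompNat.snd.add (CompNat.const 1)) (CompPred.getElem? hF.up.up CompNat.snd))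
    (Comp.bit true) Comp.nil)
  unfold CompNat
  convert h using 2 with a
  convert replicate_leadingOnes _

end Calculus

/-! ### Attainment of the minimum and invariance under isomorphism. -/

theorem guardsSuffice_evc {V : Type*} [Fintype V] (H : SimpleGraph V) : GuardsSuffice H (evc H) :=
  Nat.sInf_mem (s := {k | GuardsSuffice H k}) ⟨_, guardsSuffice_card H⟩

theorem GuardsSuffice.iso {V W : Type*} {H : SimpleGraph V} {H' : SimpleGraph W} (e : H ≃g H')
    {k : ℕ} (h : GuardsSuffice H k) : GuardsSuffice H' k := by
  obtain ⟨s, hinj, hs⟩ := h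
  refine ⟨fun h i => e (s (h.map e.symm.mapEdgeSet) i), fun h => e.injective.comp (hinj _),
    fun h f => ?_⟩
  obtain ⟨hadj, i, hi⟩ := hs (h.map e.symm.mapEdgeSet) (e.symm.mapEdgeSet f)
  refine ⟨fun j => (hadj j).imp (congrArg e) e.map_adj_iff.2, i, ?_⟩
  have h₁ := congrArg (Sym2.map e) hi
  simpa [SimpleGraph.Iso.mapEdgeSet, Sym2.map_map] using h₁

theorem evc_iso {V W : Type*} {H : SimpleGraph V} {H' : SimpleGraph W} (e : H ≃g H') :
    evc H = evc H' := by
  unfold evc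
  congr 1
  ext k
  exact ⟨fun h => h.iso e, fun h => h.iso e.symm⟩

/-! ### Defending a graph with a connected vertex cover -/

/-- A memoryless choice of responses within `I` becomes a strategy by recursion on the history. -/
theorem guardsSuffice_of_invariant {V : Type*} (H : SimpleGraph V) {k : ℕ} (I : Set (Fin k → V))
    (hne : I.Nonempty) (hinj : ∀ g ∈ I, Function.Injective g)
    (hstep : ∀ g ∈ I, ∀ e ∈ H.edgeSet, ∃ g' ∈ I, DefendsAttack H e g g') :
    GuardsSuffice H k := by
  obtain ⟨g₀, hg₀⟩ := hne
  choose next hI hnext using fun (g : I) (e : H.edgeSet) => hstep g g.2 e e.2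
  let s : List H.edgeSet → I := fun h =>
    List.rec ⟨g₀, hg₀⟩ (fun e _ g => ⟨next g e, hI g e⟩) h
  exact ⟨fun h => (s h).1, fun h => hinj _ (s h).2, fun h e => hnext (s h) e⟩

theorem SimpleGraph.Walk.adj_formPerm_support {V : Type*} [DecidableEq V]
    {H : SimpleGraph V} {x w : V} {p : H.Walk x w} (hp : p.support.Nodup) {y : V}
    (hy : y ∈ p.support) (hyw : y ≠ w) : H.Adj y (p.support.formPerm y) := by
  obtain ⟨n, hn, rfl⟩ := List.getElem_of_mem hy
  have hn' : n + 1 < p.support.length := by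
    by_contra h
    apply hyw
    have := p.getLast_support
    rw [List.getLast_eq_getElem] at this
    refine Eq.trans ?_ this
    congr 1
    omega
  rw [List.formPerm_apply_lt_getElem _ hp n hn']
  exact p.isChain_adj_support.getElem n hn'

theorem List.formPerm_append_pair_apply {V : Type*} [DecidableEq V] (l : List V) {a b : V}
    (h : (l ++ [a, b]).Nodup) : (l ++ [a, b]).formPerm a = b := by
  rw [List.formPerm_append_pair, Equiv.Perm.mul_apply, Equiv.swap_apply_left,
    List.formPerm_apply_of_notMem]
  intro hb
  rw [List.append_cons, List.nodup_append] at h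
  exact h.2.2 b hb b (by simp) rfl

/-- Moving every guard along a path from `x` to `w` whose inner vertices are in `D`. -/
theorem exists_shift {V : Type*} {H : SimpleGraph V} {D : Set V}
    (hconn : (H.induce D).Preconnected) {x y v w : V} (hx : x ∉ D) (hw : w ∉ D) (hxw : x ≠ w)
    (hy : y ∈ D) (hv : v ∈ D) (hxy : H.Adj x y) (hvw : H.Adj v w) :
    ∃ τ : Equiv.Perm V, (∀ z ∈ insert x D, τ z = z ∨ H.Adj z (τ z)) ∧ τ v = w ∧
      τ '' insert x D = insert w D := by
  classical
  obtain ⟨q, hq⟩ := (hconn ⟨y, hy⟩ ⟨v, hv⟩).exists_isPath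
  let q' : H.Walk y v := q.map (SimpleGraph.Embedding.induce D).toHom
  have hq' : q'.IsPath := hq.map (f := (SimpleGraph.Embedding.induce D).toHom)
    (SimpleGraph.Embedding.induce (G := H) D).injective
  have hD : ∀ z ∈ q'.support, z ∈ D := by
    intro z hz
    have hq'' : q'.support = q.support.map fun a => a.1 := SimpleGraph.Walk.support_map _ _
    rw [hq'', List.mem_map] at hz
    obtain ⟨a, -, rfl⟩ := hz
    exact a.2
  let p : H.Walk x w := (SimpleGraph.Walk.cons hxy q').concat hvw
  have hsupp : p.support = x :: (q'.support ++ [w]) := by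
    simp [p, SimpleGraph.Walk.support_concat]
  have hnodup : p.support.Nodup := by
    rw [hsupp, List.nodup_cons, List.nodup_append]
    refine ⟨?_, hq'.support_nodup, by simp, ?_⟩
    · simp only [List.mem_append, List.mem_singleton, not_or]
      exact ⟨fun h => hx (hD x h), hxw⟩
    · rintro a ha b hb rfl
      rw [List.mem_singleton] at hb
      exact hw (hb ▸ hD a ha)
  -- The cyclic permutation along the path advances every vertex by one edge. Its only jump that
  -- need not be an edge is from `w` back to `x`, and `w` carries no guard.
  set τ := p.support.formPerm with hτ
  have hlast : τ w = x := by
    rw [hτ, hsupp, List.formPerm_cons_concat_apply_last]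
  have hpsub : ∀ z ∈ p.support, z = x ∨ z ∈ D ∨ z = w := by
    intro z hz
    rw [hsupp, List.mem_cons, List.mem_append, List.mem_singleton] at hz
    exact hz.imp_right fun h => h.imp_left (hD z)
  have hτmem : ∀ z, τ z ∈ p.support ↔ z ∈ p.support := fun z => List.formPerm_mem_iff_mem
  have hxp : x ∈ p.support := p.start_mem_support
  have hwp : w ∈ p.support := p.end_mem_support
  refine ⟨τ, fun z hz => ?_, ?_, ?_⟩
  · by_cases hzp : z ∈ p.support
    · refine Or.inr (SimpleGraph.Walk.adj_formPerm_support hnodup hzp ?_)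
      rintro rfl
      rcases hz with h | h
      · exact hxw h.symm
      · exact hw h
    · exact Or.inl (List.formPerm_apply_of_notMem hzp)
  · have h₁ : q'.support = q'.support.dropLast ++ [v] := by
      conv_lhs => rw [← List.dropLast_append_getLast q'.support_ne_nil, q'.getLast_support]
    have h₂ : p.support = (x :: q'.support.dropLast) ++ [v, w] := by
      rw [hsupp, List.cons_append]
      conv_lhs => rw [h₁, List.append_assoc]
      rfl
    rw [h₂] at hnodup
    rw [hτ, h₂]
    exact List.formPerm_append_pair_apply _ hnodup
  · ext z
    constructor
    · rintro ⟨a, ha, rfl⟩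
      have haw : a ≠ w := by
        rintro rfl
        rcases ha with h | h
        · exact hxw h.symm
        · exact hw h
      by_cases hap : a ∈ p.support
      · rcases hpsub _ ((hτmem a).2 hap) with h | h | h
        · exact absurd (τ.injective (h.trans hlast.symm)) haw
        · exact Set.mem_insert_of_mem _ h
        · rw [h]; exact Set.mem_insert _ _
      · rw [hτ, List.formPerm_apply_of_notMem hap]
        rcases ha with h | h
        · exact absurd (h ▸ hxp) hap
        · exact Set.mem_insert_of_mem _ h
    · intro hz
      obtain ⟨a, rfl⟩ := τ.surjective z
      refine ⟨a, ?_, rfl⟩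
      by_cases hap : a ∈ p.support
      · rcases hpsub _ hap with h | h | h
        · rw [h]; exact Set.mem_insert _ _
        · exact Set.mem_insert_of_mem _ h
        · rw [h, hlast] at hz
          rcases hz with h' | h'
          · exact absurd h' hxw
          · exact absurd h' hx
      · rw [hτ, List.formPerm_apply_of_notMem hap] at hz
        rcases hz with h | h
        · exact absurd (h ▸ hwp) hap
        · exact Set.mem_insert_of_mem _ h

/-- Invariant: the guards fill `D` and one further vertex `x` with a neighbour in `D`. An edge with
both ends guarded is defended by a swap. Otherwise it joins `v ∈ D` to an unguarded `w`; shifting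
along a path from `x` through `D` to `v` and `w` makes `w` the new extra vertex, adjacent to `v`. -/
theorem guardsSuffice_of_connected_cover {V : Type*} {H : SimpleGraph V} (D : Finset V)
    (hcov : ∀ v w, H.Adj v w → v ∈ D ∨ w ∈ D) (hconn : (H.induce (D : Set V)).Preconnected)
    {x₀ y₀ : V} (hx₀ : x₀ ∉ D) (hy₀ : y₀ ∈ D) (hadj : H.Adj x₀ y₀) :
    GuardsSuffice H (D.card + 1) := by
  classical
  refine guardsSuffice_of_invariant H {g | Function.Injective g ∧ ∃ x ∉ D, (∃ y ∈ D, H.Adj x y) ∧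
    Set.range g = insert x (D : Set V)} ?_ (fun g hg => hg.1) ?_
  · let e := (insert x₀ D).equivFinOfCardEq (Finset.card_insert_of_notMem hx₀)
    refine ⟨fun i => e.symm i, Subtype.val_injective.comp e.symm.injective, x₀, hx₀,
      ⟨y₀, hy₀, hadj⟩, ?_⟩
    rw [show (fun i => (e.symm i : V)) = Subtype.val ∘ e.symm from rfl, Set.range_comp,
      e.symm.surjective.range_eq, Set.image_univ, Subtype.range_coe]
    simp
  · rintro g ⟨hg, x, hx, ⟨y, hy, hxy⟩, hr⟩ e he
    have hmem : ∀ i, g i ∈ insert x (D : Set V) := fun i => hr ▸ Set.mem_range_self i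
    have key : ∀ v w, s(v, w) = e → v ∈ D → ∃ g' ∈ {g | Function.Injective g ∧ ∃ x ∉ D,
        (∃ y ∈ D, H.Adj x y) ∧ Set.range g = insert x (D : Set V)}, DefendsAttack H e g g' := by
      rintro v w rfl hv
      rw [SimpleGraph.mem_edgeSet] at he
      obtain ⟨i, hi⟩ : v ∈ Set.range g := by rw [hr]; exact Set.mem_insert_of_mem _ hv
      by_cases hw : w ∈ insert x (D : Set V)
      · refine ⟨Equiv.swap v w ∘ g, ⟨(Equiv.injective _).comp hg, x, hx, ⟨y, hy, hxy⟩, ?_⟩,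
          fun j => ?_, i, ?_⟩
        · rw [Set.range_comp, hr]
          have hv' : v ∈ insert x (D : Set V) := Set.mem_insert_of_mem _ hv
          ext z
          rw [Equiv.image_eq_preimage_symm, Set.mem_preimage, Equiv.symm_swap]
          rcases eq_or_ne z v with rfl | h₁
          · rw [Equiv.swap_apply_left]; exact iff_of_true hw hv'
          · rcases eq_or_ne z w with rfl | h₂
            · rw [Equiv.swap_apply_right]; exact iff_of_true hv' hw
            · rw [Equiv.swap_apply_of_ne_of_ne h₁ h₂]
        · rw [Function.comp_apply]
          rcases eq_or_ne (g j) v with h₁ | h₁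
          · rw [h₁, Equiv.swap_apply_left]; exact Or.inr he
          · rcases eq_or_ne (g j) w with h₂ | h₂
            · rw [h₂, Equiv.swap_apply_right]; exact Or.inr he.symm
            · exact Or.inl (Equiv.swap_apply_of_ne_of_ne h₁ h₂)
        · rw [Function.comp_apply, hi, Equiv.swap_apply_left]
      · have hw' := fun h => hw (Set.mem_insert_of_mem _ h)
        have hxw : x ≠ w := fun h => hw (h ▸ Set.mem_insert _ _)
        obtain ⟨τ, h₁, h₂, h₃⟩ := exists_shift hconn hx hw' hxw hy hv hxy he
        refine ⟨τ ∘ g, ⟨τ.injective.comp hg, w, hw', ⟨v, hv, he.symm⟩, ?_⟩,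
          fun j => h₁ _ (hmem j), i, ?_⟩
        · rw [Set.range_comp, hr, h₃]
        · rw [Function.comp_apply, hi, h₂]
    obtain ⟨⟨v, w⟩, rfl⟩ := Quot.exists_rep e
    rcases hcov v w he with h | h
    · exact key v w rfl h
    · exact key w v Sym2.eq_swap h

/-! ### The graph of the reduction -/

section Reduction

variable {R B L : Type} {G : R → B → Prop}

/-- The edges of the reduction, directed: an additional blue vertex `none` is joined to all red
vertices, and every blue vertex gets a leaf for every element of `L`. -/
def reductionArc (G : R → B → Prop) :
    R ⊕ (Option B ⊕ L × Option B) → R ⊕ (Option B ⊕ L × Option B) → Prop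
  | .inl r, .inr (.inl u) => ∀ v ∈ u, G r v
  | .inr (.inl u), .inr (.inr l) => u = l.2
  | _, _ => False

/-- The graph to which the reduction maps a red-blue graph. -/
def reductionGraph (L : Type) (G : R → B → Prop) :
    SimpleGraph (R ⊕ (Option B ⊕ L × Option B)) where
  Adj v w := reductionArc G v w ∨ reductionArc G w v
  symm := ⟨fun _ _ => Or.symm⟩
  loopless := ⟨fun v h => by rcases v with r | u | l <;> simp [reductionArc] at h⟩

theorem reductionGraph_isBipartite : (reductionGraph L G).IsBipartite := by
  let c : (reductionGraph L G).Coloring (Fin 2) := SimpleGraph.Coloring.mk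
    (fun v => match v with
      | .inr (.inl _) => 1
      | _ => 0) (by
    rintro (r | u | l) (r' | u' | l') h <;> simp [reductionGraph, reductionArc] at h ⊢)
  exact ⟨c⟩

theorem edist_le_succ {V : Type*} {H : SimpleGraph V} {u v w : V} {n : ℕ}
    (h : H.edist u v ≤ n) (hvw : H.Adj v w) : H.edist u w ≤ (n + 1 : ℕ) := by
  refine (SimpleGraph.edist_triangle (v := v)).trans ?_
  rw [Nat.cast_add]
  exact add_le_add h (by rw [SimpleGraph.edist_eq_one_iff_adj.2 hvw]; rfl)

/-- Every vertex is within distance three of the extra blue vertex: red vertices at one, blue ones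
at most two (by `hG`), leaves at most three. -/
theorem reductionGraph_ediam_le (hG : ∀ u, ∃ r, G r u) : (reductionGraph L G).ediam ≤ 6 := by
  have hr : ∀ r, (reductionGraph L G).edist (.inr (.inl none)) (.inl r) ≤ (1 : ℕ) := fun r =>
    edist_le_succ (n := 0) (v := .inr (.inl none)) (by simp) (by simp [reductionGraph, reductionArc])
  have hu : ∀ u, (reductionGraph L G).edist (.inr (.inl none)) (.inr (.inl u)) ≤ (2 : ℕ) := by
    rintro (_ | u)
    · simp
    · obtain ⟨r, h⟩ := hG u
      exact edist_le_succ (hr r) (by simpa [reductionGraph, reductionArc] using h)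
  have hl : ∀ v, (reductionGraph L G).edist (.inr (.inl none)) v ≤ (3 : ℕ) := by
    rintro (r | u | l)
    · exact (hr r).trans (by norm_num)
    · exact (hu u).trans (by norm_num)
    · exact edist_le_succ (hu l.2) (by simp [reductionGraph, reductionArc])
  refine SimpleGraph.ediam_le_of_edist_le fun v w =>
    (SimpleGraph.edist_triangle (v := .inr (.inl none))).trans
    ((add_le_add (SimpleGraph.edist_comm.trans_le (hl v)) (hl w)).trans (by norm_num))

theorem guardsSuffice_reductionGraph [Finite R] [Fintype B] [Nonempty L] {S : Finset R}
    (hS : ∀ u, ∃ r ∈ S, G r u) :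
    GuardsSuffice (reductionGraph L G) (S.card + (Fintype.card B + 1) + 1) := by
  classical
  let D : Finset (R ⊕ (Option B ⊕ L × Option B)) :=
    S.disjSum ((Finset.univ : Finset (Option B)).map ⟨Sum.inl, Sum.inl_injective⟩)
  have hD : D.card = S.card + (Fintype.card B + 1) := by
    simp [D]
  have hb : ∀ u : Option B, (.inr (.inl u)) ∈ D := fun u => by simp [D]
  have hs : ∀ r ∈ S, (.inl r) ∈ D := fun r hr => by simpa [D] using hr
  obtain ⟨l⟩ := ‹Nonempty L›
  rw [← hD]
  refine guardsSuffice_of_connected_cover D ?_ ?_ (x₀ := .inr (.inr (l, none)))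
    (y₀ := .inr (.inl none)) (by simp [D]) (hb none) (by simp [reductionGraph, reductionArc])
  · rintro (r | u | l) (r' | u' | l') h <;> simp [reductionGraph, reductionArc] at h <;>
      simp [hb]
  · let H := (reductionGraph L G).induce (D : Set (R ⊕ (Option B ⊕ L × Option B)))
    have hr : ∀ r (hr : r ∈ S), H.Reachable ⟨.inr (.inl none), hb none⟩ ⟨.inl r, hs r hr⟩ :=
      fun r hr => SimpleGraph.Adj.reachable (by simp [H, reductionGraph, reductionArc])
    have hv : ∀ v : D, H.Reachable ⟨.inr (.inl none), hb none⟩ v := by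
      rintro ⟨r | u | l, h⟩
      · exact hr r (by simpa [D] using h)
      · rcases u with _ | u
        · rfl
        · obtain ⟨r, hrS, hG⟩ := hS u
          exact (hr r hrS).trans
            (SimpleGraph.Adj.reachable (by simpa [H, reductionGraph, reductionArc] using hG))
      · simp [D] at h
    exact fun v w => (hv v).symm.trans (hv w)

theorem exists_dominating_of_guardsSuffice [Fintype B] [Fintype L] {n : ℕ}
    (hn : n < Fintype.card L) (hG : ∀ u, ∃ r, G r u) (h : GuardsSuffice (reductionGraph L G) n) :
    ∃ S : Finset R, S.card + (Fintype.card B + 2) ≤ n ∧ ∀ u, ∃ r ∈ S, G r u := by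
  classical
  obtain ⟨s, hinj, hs⟩ := h
  have hedge : ∀ (l : L) (u : Option B),
      s(.inr (.inl u), .inr (.inr (l, u))) ∈ (reductionGraph L G).edgeSet := fun l u => by
    simp [reductionGraph, reductionArc]
  have hleaf : ∀ (u : Option B) (g : Fin n → R ⊕ (Option B ⊕ L × Option B)),
      ∃ l, ∀ i, g i ≠ .inr (.inr (l, u)) := by
    intro u g
    by_contra! hc
    choose i hi using hc
    have : Function.Injective i := fun l l' hl => by
      have := (hi l).symm.trans (hl ▸ hi l')
      simpa using this
    have := Fintype.card_le_of_injective i this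
    simp at this
    omega
  -- A guard defending the edge to a free leaf can only come from the blue end.
  have hocc : ∀ (h : List (reductionGraph L G).edgeSet) (u : Option B),
      ∃ i, s h i = .inr (.inl u) := by
    intro h u
    by_contra! hc
    obtain ⟨l, hl⟩ := hleaf u (s h)
    obtain ⟨-, i, hi⟩ := hs h ⟨_, hedge l u⟩
    rcases Sym2.eq_iff.1 hi with ⟨h₁, -⟩ | ⟨h₁, -⟩
    · exact hc i h₁
    · exact hl i h₁
  -- The defender leaves `u` for the leaf, yet `u` must be occupied afterwards, so a second guard
  -- enters it from a neighbour.
  have hmove : ∀ (h : List (reductionGraph L G).edgeSet) (u : Option B), ∃ l,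
      (∃ i, s (⟨_, hedge l u⟩ :: h) i = .inr (.inr (l, u))) ∧
      ∃ j, s h j ≠ .inr (.inl u) ∧ (reductionGraph L G).Adj (s h j) (.inr (.inl u)) := by
    intro h u
    obtain ⟨l, hl⟩ := hleaf u (s h)
    obtain ⟨hadj, i, hi⟩ := hs h ⟨_, hedge l u⟩
    have hi' : s h i = .inr (.inl u) ∧ s (⟨_, hedge l u⟩ :: h) i = .inr (.inr (l, u)) := by
      rcases Sym2.eq_iff.1 hi with h₁ | ⟨h₁, -⟩
      · exact h₁
      · exact absurd h₁ (hl i)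
    refine ⟨l, ⟨i, hi'.2⟩, ?_⟩
    obtain ⟨j, hj⟩ := hocc (⟨_, hedge l u⟩ :: h) u
    have hij : j ≠ i := by
      rintro rfl
      rw [hi'.2] at hj
      simp at hj
    have hju : s h j ≠ .inr (.inl u) := fun hc => hij (hinj h (hc.trans hi'.1.symm))
    refine ⟨j, hju, ?_⟩
    rcases hadj j with h₁ | h₁
    · exact absurd (h₁.symm.trans hj) hju
    · rwa [hj] at h₁
  obtain ⟨l, ⟨i₀, hi₀⟩, -⟩ := hmove [] none
  set h : List (reductionGraph L G).edgeSet := [⟨_, hedge l none⟩]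
  choose i hi using hocc h
  choose ν hν using hG
  -- A guard on a leaf of `u` can refill only `u`, so a red neighbour of `u` replaces it. Blue
  -- vertices and leaves of `none` contribute nothing.
  let f : R ⊕ (Option B ⊕ L × Option B) → Finset R := fun v => match v with
    | .inl r => {r}
    | .inr (.inr (_, some u)) => {ν u}
    | _ => ∅
  have hf : ∀ v, (f v).card ≤ 1 := by
    rintro (r | u | ⟨l, _ | u⟩) <;> simp [f]
  let A : Finset (Fin n) := Finset.univ.filter fun j => f (s h j) ≠ ∅
  -- These `b + 2` distinct guards, one on the leaf of `none` and one on each blue vertex,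
  -- contribute no red vertex.
  let e : Option (Option B) → Fin n := fun o => o.elim i₀ i
  have he : Function.Injective e := by
    have h₁ : ∀ u, i₀ ≠ i u := fun u hu => by
      have := hi u
      rw [← hu, hi₀] at this
      simp at this
    rintro (_ | u) (_ | u') huu'
    · rfl
    · exact absurd huu' (h₁ u')
    · exact absurd huu'.symm (h₁ u)
    · have := (hi u).symm.trans ((congrArg (s h) huu').trans (hi u'))
      simpa using this
  have hA : Disjoint A (Finset.univ.image e) := by
    rw [Finset.disjoint_right]
    intro j hj
    obtain ⟨o, -, rfl⟩ := Finset.mem_image.1 hj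
    rcases o with _ | u
    · simp [A, e, hi₀, f]
    · simp [A, e, hi, f]
  have hcard : A.card + (Fintype.card B + 2) ≤ n := by
    have h₁ := Finset.card_le_univ (A ∪ Finset.univ.image e)
    rw [Finset.card_union_of_disjoint hA, Finset.card_image_of_injective _ he] at h₁
    simpa using h₁
  refine ⟨A.biUnion fun j => f (s h j), ?_, fun u => ?_⟩
  · have := Finset.card_biUnion_le_card_mul A (fun j => f (s h j)) 1 fun j _ => hf _
    omega
  · obtain ⟨-, -, j, -, hj⟩ := hmove h (some u)
    have hmem : ∀ r, r ∈ f (s h j) → r ∈ A.biUnion fun j => f (s h j) := fun r hr =>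
      Finset.mem_biUnion.2 ⟨j, by simpa [A] using Finset.ne_empty_of_mem hr, hr⟩
    rcases hv : s h j with r | u' | ⟨l', u'⟩ <;> rw [hv] at hj hmem
    · exact ⟨r, hmem r (by simp [f]), by simpa [reductionGraph, reductionArc] using hj⟩
    · simp [reductionGraph, reductionArc] at hj
    · have hu : some u = u' := by simpa [reductionGraph, reductionArc] using hj
      subst hu
      exact ⟨ν u, hmem _ (by simp [f]), hν u⟩

/-- If no blue vertex is isolated, the reduction is correct. -/
theorem evc_reductionGraph_le_iff [Finite R] [Fintype B] [Fintype L] {k : ℕ}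
    (hL : Fintype.card B + k + 2 < Fintype.card L) (hG : ∀ u, ∃ r, G r u) :
    evc (reductionGraph L G) ≤ Fintype.card B + k + 2 ↔
      ∃ S : Finset R, S.card ≤ k ∧ ∀ u, ∃ r ∈ S, G r u := by
  have := Fintype.ofFinite R
  constructor
  · intro h
    obtain ⟨S, hS, hdom⟩ := exists_dominating_of_guardsSuffice (by omega) hG
      (guardsSuffice_evc (reductionGraph L G))
    exact ⟨S, by omega, hdom⟩
  · rintro ⟨S, hS, hdom⟩
    have : Nonempty L := Fintype.card_pos_iff.1 (by omega)
    have h := Nat.sInf_le (s := {k | GuardsSuffice (reductionGraph L G) k})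
      (guardsSuffice_reductionGraph hdom)
    rw [evc]
    omega

end Reduction

/-! ### Complete bipartite graphs -/

/-- The complete bipartite graph whose sides are the numbers below `n` and the other numbers. -/
def splitGraph (n N : ℕ) : SimpleGraph (Fin N) where
  Adj v w := (v < n ∧ n ≤ w) ∨ (w < n ∧ n ≤ v)
  symm := ⟨fun _ _ => Or.symm⟩
  loopless := ⟨fun v h => by omega⟩

theorem splitGraph_isBipartite (n N : ℕ) : (splitGraph n N).IsBipartite := by
  let c : (splitGraph n N).Coloring (Fin 2) := SimpleGraph.Coloring.mk
    (fun v => if v < n then 0 else 1) (by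
    intro v w h
    rcases h with h | h
    · simp [h.1, h.2.not_gt]
    · simp [h.1, h.2.not_gt])
  exact ⟨c⟩

theorem splitGraph_ediam_le {n : ℕ} (hn : 0 < n) : (splitGraph n (n + n)).ediam ≤ 6 := by
  have h₁ : ∀ v w : Fin (n + n), (v < n ↔ ¬ w < n) → (splitGraph n (n + n)).Adj v w := by
    intro v w h
    change _ ∨ _
    omega
  refine SimpleGraph.ediam_le_of_edist_le fun v w => ?_
  have h₂ : (splitGraph n (n + n)).edist v w ≤ (2 : ℕ) := by
    by_cases h : (v < n ↔ ¬ w < n)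
    · exact (edist_le_succ (n := 0) (by simp) (h₁ v w h)).trans (by norm_num)
    · obtain ⟨x, hx⟩ : ∃ x : Fin (n + n), (v < n ↔ ¬ x < n) := by
        by_cases hv : v < n
        · exact ⟨⟨n, by omega⟩, by simpa using hv⟩
        · exact ⟨⟨0, by omega⟩, by simp [hn]; omega⟩
      exact edist_le_succ (edist_le_succ (n := 0) (by simp) (h₁ v x hx)) (h₁ x w (by tauto))
  exact h₂.trans (by norm_num)

/-- The initial positions form a vertex cover, as an edge with two unguarded ends cannot be
defended. A vertex cover of a complete bipartite graph contains a whole side. -/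
theorem le_evc_splitGraph (n : ℕ) : n ≤ evc (splitGraph n (n + n)) := by
  obtain ⟨s, -, hs⟩ := guardsSuffice_evc (splitGraph n (n + n))
  have key : ∀ j : Fin n → Fin (n + n), Function.Injective j → (∀ x, ∃ i, s [] i = j x) →
      n ≤ evc (splitGraph n (n + n)) := by
    intro j hj h
    choose i hi using h
    have hinj : Function.Injective i := fun x y hxy => hj (by rw [← hi, ← hi, hxy])
    simpa using Fintype.card_le_of_injective i hinj
  by_cases h₁ : ∀ x : Fin n, ∃ i, s [] i = Fin.castAdd n x
  · exact key _ (Fin.castAdd_injective n n) h₁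
  · by_cases h₂ : ∀ x : Fin n, ∃ i, s [] i = Fin.natAdd n x
    · exact key _ (Fin.natAdd_injective n n) h₂
    · push Not at h₁ h₂
      obtain ⟨x, hx⟩ := h₁
      obtain ⟨y, hy⟩ := h₂
      obtain ⟨-, i, hi⟩ := hs [] ⟨s(Fin.castAdd n x, Fin.natAdd n y), by simp [splitGraph]⟩
      rcases Sym2.eq_iff.1 hi with ⟨h, -⟩ | ⟨h, -⟩
      · exact absurd h (hx i)
      · exact absurd h (hy i)

theorem SimpleGraph.Iso.edist_le {V W : Type*} {H : SimpleGraph V} {H' : SimpleGraph W}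
    (e : H ≃g H') (v w : V) : H'.edist (e v) (e w) ≤ H.edist v w := by
  refine le_iInf fun p => ?_
  have h := SimpleGraph.edist_le (p.map e.toHom)
  rwa [SimpleGraph.Walk.length_map] at h

theorem SimpleGraph.Iso.ediam_le {V W : Type*} {H : SimpleGraph V} {H' : SimpleGraph W}
    (e : H ≃g H') {n : ℕ∞} (h : H.ediam ≤ n) : H'.ediam ≤ n := by
  refine SimpleGraph.ediam_le_of_edist_le fun v w => ?_
  obtain ⟨v, rfl⟩ := e.surjective v
  obtain ⟨w, rfl⟩ := e.surjective w
  exact (e.edist_le v w).trans (SimpleGraph.edist_le_ediam.trans h)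

/-! ### Words and graphs -/

theorem leadingOnes_replicate_append (n : ℕ) (w : List Bool) :
    leadingOnes (List.replicate n true ++ false :: w) = n := by
  simp [leadingOnes]

theorem drop_replicate_append (n : ℕ) (w : List Bool) :
    (List.replicate n true ++ false :: w).drop (n + 1) = w := by
  simp [List.drop_append]

theorem eq_replicate_append_of_leadingOnes_lt {w : List Bool} (h : leadingOnes w < w.length) :
    w = List.replicate (leadingOnes w) true ++ false :: w.drop (leadingOnes w + 1) := by
  induction w with
  | nil => simp at h
  | cons b w ih =>
    cases b
    · simp [leadingOnes]
    · have h₁ : leadingOnes (true :: w) = leadingOnes w + 1 := by simp [leadingOnes]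
      rw [h₁] at h ⊢
      rw [List.replicate_succ, List.cons_append, List.drop_succ_cons,
        ← ih (by simpa using h)]

open Classical in
-- The flat indexing gives access to single entries, the length, and injectivity of the encoding.
theorem encodeMatrix_eq_ofFn {m n : ℕ} (M : Fin m → Fin n → Prop) :
    encodeMatrix M = List.ofFn fun k : Fin (m * n) => decide (M k.divNat k.modNat) := by
  rw [List.ofFn_mul, encodeMatrix]
  congr 1
  congr 1
  funext i
  congr 1
  funext j
  have hn : 0 < n := j.pos
  congr 2
  · ext
    simp [Fin.divNat, Nat.add_div_of_dvd_right, Nat.mul_div_cancel _ hn, Nat.div_eq_of_lt j.2]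
  · ext
    simp [Fin.modNat, Nat.mod_eq_of_lt j.2]

open Classical in
/-- The word for the graph with the vertices below `N` and the adjacency relation `A`. -/
noncomputable def graphWord (N : ℕ) (A : ℕ → ℕ → Prop) : List Bool :=
  List.replicate N true ++ false ::
    (List.range N).flatMap fun p => (List.range N).flatMap fun q => [decide (A p q)]

theorem flatten_ofFn {β : Type*} (n : ℕ) (f : ℕ → List β) :
    (List.ofFn fun i : Fin n => f i).flatten = (List.range n).flatMap f := by
  rw [List.flatMap_def, ← List.map_coe_finRange_eq_range, List.map_map, List.ofFn_eq_map]
  rfl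

theorem encodeGraph_eq_graphWord {N : ℕ} (H : SimpleGraph (Fin N)) (A : ℕ → ℕ → Prop)
    (h : ∀ v w, H.Adj v w ↔ A v w) : encodeGraph H = graphWord N A := by
  classical
  rw [encodeGraph, graphWord, encodeMatrix, ← flatten_ofFn]
  congr 4
  funext i
  rw [← flatten_ofFn]
  simp only [h, List.ofFn_eq_map]
  generalize List.finRange N = l
  induction l with
  | nil => rfl
  | cons a l ih => simpa using ih

/-- The leading ones determine the number of vertices and the rest the adjacency. Concluding only
about `evc` avoids comparing graphs on different types. -/
theorem encodeGraph_injective {n n' : ℕ} {H : SimpleGraph (Fin n)} {H' : SimpleGraph (Fin n')}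
    (h : encodeGraph H = encodeGraph H') : evc H = evc H' := by
  have h₁ := congrArg leadingOnes h
  simp only [encodeGraph, leadingOnes_replicate_append] at h₁
  subst h₁
  have h₂ : encodeMatrix H.Adj = encodeMatrix H'.Adj := by
    simpa [encodeGraph] using h
  rw [encodeMatrix_eq_ofFn, encodeMatrix_eq_ofFn] at h₂
  have h₃ := List.ofFn_injective h₂
  congr 1
  ext v w
  have h₄ := congrFun h₃ (finProdFinEquiv (v, w))
  have h₅ : (finProdFinEquiv (v, w)).divNat = v ∧ (finProdFinEquiv (v, w)).modNat = w := by
    have := finProdFinEquiv.symm_apply_apply (v, w)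
    exact ⟨congrArg Prod.fst this, congrArg Prod.snd this⟩
  simpa [h₅.1, h₅.2] using h₄

/-! ### Reading an instance of Red Blue Dominating Set -/

/-- The number of red vertices in the word of a red-blue graph. -/
def redCount (x : List Bool) : ℕ := leadingOnes x

/-- The number of blue vertices in the word of a red-blue graph. -/
def blueCount (x : List Bool) : ℕ := leadingOnes (x.drop (redCount x + 1))

/-- The matrix in the word of a red-blue graph. -/
def matrixPart (x : List Bool) : List Bool := (x.drop (redCount x + 1)).drop (blueCount x + 1)

/-- The adjacency of the red vertex `p` and the blue vertex `u` in the word of a red-blue graph. -/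
def IsEdge (x : List Bool) (p u : ℕ) : Prop := (matrixPart x)[p * blueCount x + u]? = some true

/-- The word `x` encodes a red-blue graph with at most `κ` blue vertices. -/
def IsInstance (I : List Bool × ℕ) : Prop :=
  I.1.length = redCount I.1 + blueCount I.1 + redCount I.1 * blueCount I.1 + 2 ∧
    blueCount I.1 ≤ I.2

/-- No blue vertex is isolated. -/
def NoIsolated (x : List Bool) : Prop :=
  ∀ u < blueCount x, ∃ p < redCount x, IsEdge x p u

section Encoded

variable {r b : ℕ} (G : RedBlueGraph r b)

theorem length_encodeMatrix {m n : ℕ} (M : Fin m → Fin n → Prop) :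
    (encodeMatrix M).length = m * n := by
  rw [encodeMatrix_eq_ofFn, List.length_ofFn]

theorem redCount_encode : redCount (encodeRedBlueGraph G) = r :=
  leadingOnes_replicate_append _ _

theorem blueCount_encode : blueCount (encodeRedBlueGraph G) = b := by
  rw [blueCount, redCount_encode, encodeRedBlueGraph, drop_replicate_append,
    leadingOnes_replicate_append]

theorem matrixPart_encode : matrixPart (encodeRedBlueGraph G) = encodeMatrix G := by
  rw [matrixPart, redCount_encode, blueCount_encode, encodeRedBlueGraph, drop_replicate_append,
    drop_replicate_append]

theorem isEdge_encode (p : Fin r) (u : Fin b) : IsEdge (encodeRedBlueGraph G) p u ↔ G p u := by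
  have hlt : (p : ℕ) * b + u < r * b := by
    have h₁ := Nat.mul_le_mul_right b p.2
    have h₂ := u.2
    rw [Nat.succ_mul] at h₁
    omega
  have hb : 0 < b := u.pos
  rw [IsEdge, matrixPart_encode, blueCount_encode, encodeMatrix_eq_ofFn, List.getElem?_ofFn,
    dif_pos hlt]
  have h₁ : (⟨p * b + u, hlt⟩ : Fin (r * b)).divNat = p := by
    ext
    simp [Fin.divNat, Nat.add_div_of_dvd_right, Nat.mul_div_cancel _ hb, Nat.div_eq_of_lt u.2]
  have h₂ : (⟨p * b + u, hlt⟩ : Fin (r * b)).modNat = u := by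
    ext
    simp [Fin.modNat, Nat.mod_eq_of_lt u.2]
  simp [h₁, h₂]

theorem isInstance_encode (k : ℕ) : IsInstance (encodeRedBlueGraph G, b + k) := by
  refine ⟨?_, ?_⟩
  · simp only [redCount_encode, blueCount_encode]
    simp only [encodeRedBlueGraph, List.length_append, List.length_cons, List.length_replicate,
      length_encodeMatrix]
    ring
  · simp only [blueCount_encode]
    omega

theorem noIsolated_encode : NoIsolated (encodeRedBlueGraph G) ↔ ∀ u, ∃ r, G r u := by
  simp only [NoIsolated, redCount_encode, blueCount_encode]
  constructor
  · intro h u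
    obtain ⟨p, hp, he⟩ := h u u.2
    exact ⟨⟨p, hp⟩, (isEdge_encode G ⟨p, hp⟩ u).1 he⟩
  · intro h u hu
    obtain ⟨p, hp⟩ := h ⟨u, hu⟩
    exact ⟨p, p.2, (isEdge_encode G p ⟨u, hu⟩).2 hp⟩

/-- The length condition forces both separating zeros to be present and leaves exactly the matrix
entries after them. -/
theorem IsInstance.exists_encode {I : List Bool × ℕ} (h : IsInstance I) :
    ∃ (r b : ℕ) (G : RedBlueGraph r b) (k : ℕ), I = (encodeRedBlueGraph G, b + k) := by
  obtain ⟨x, κ⟩ := I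
  obtain ⟨hlen, hκ⟩ := h
  simp only at hlen hκ
  refine ⟨redCount x, blueCount x, fun p u => IsEdge x p u, κ - blueCount x, ?_⟩
  have h₁ := eq_replicate_append_of_leadingOnes_lt (w := x) (by
    change redCount x < _
    omega)
  have hlen₂ : (x.drop (redCount x + 1)).length =
      blueCount x + redCount x * blueCount x + 1 := by
    rw [List.length_drop]; omega
  have h₂ := eq_replicate_append_of_leadingOnes_lt (w := x.drop (redCount x + 1)) (by
    change blueCount x < _
    omega)
  have hlen₃ : (matrixPart x).length = redCount x * blueCount x := by
    rw [matrixPart, List.length_drop]; omega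
  have h₃ : encodeMatrix (fun (p : Fin (redCount x)) (u : Fin (blueCount x)) => IsEdge x p u) =
      matrixPart x := by
    rw [encodeMatrix_eq_ofFn]
    refine List.ext_getElem (by simp [hlen₃]) fun i hi hi' => ?_
    simp only [List.getElem_ofFn, IsEdge, Fin.divNat, Fin.modNat, Nat.div_add_mod',
      List.getElem?_eq_getElem hi', Option.some.injEq]
    simp
  rw [Nat.add_sub_cancel' hκ, encodeRedBlueGraph, h₃]
  exact Prod.ext (h₁.trans (congrArg _ (congrArg _ h₂))) rfl

end Encoded

/-! ### The adjacency matrix of the reduction -/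

/-- The arcs of the reduction for a graph with `r` red and `b` blue vertices, with `m` leaves at
every blue vertex, in terms of vertex numbers. -/
def NatArc (r b m : ℕ) (E : ℕ → ℕ → Prop) (p q : ℕ) : Prop :=
  (p < r ∧ (q = r + b ∨ ∃ u < b, q = r + u ∧ E p u)) ∨
    ∃ u < b + 1, ∃ c < m, p = r + u ∧ q = r + ((b + 1) + (u + (b + 1) * c))

/-- The numbering of the vertices of the reduction. -/
def vertexEquiv (r b m : ℕ) :
    Fin r ⊕ (Option (Fin b) ⊕ Fin m × Option (Fin b)) ≃
      Fin (r + ((b + 1) + m * (b + 1))) :=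
  (Equiv.sumCongr (Equiv.refl _) ((Equiv.sumCongr finSuccEquivLast.symm
    ((Equiv.prodCongr (Equiv.refl _) finSuccEquivLast.symm).trans finProdFinEquiv)).trans
      finSumFinEquiv)).trans finSumFinEquiv

/-- Red vertices come first, then the blue ones with `none` last, then the leaves. The blue vertex
of a leaf is recovered from its number modulo `b + 1`. -/
theorem natArc_vertexEquiv {r b m : ℕ} (G : RedBlueGraph r b) (E : ℕ → ℕ → Prop)
    (hE : ∀ (p : Fin r) (u : Fin b), E p u ↔ G p u)
    (v w : Fin r ⊕ (Option (Fin b) ⊕ Fin m × Option (Fin b))) :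
    NatArc r b m E (vertexEquiv r b m v) (vertexEquiv r b m w) ↔ reductionArc G v w := by
  have hr : ∀ p : Fin r, (vertexEquiv r b m (.inl p) : ℕ) = p := fun p => by
    simp [vertexEquiv]
  have hb : ∀ u, (vertexEquiv r b m (.inr (.inl u)) : ℕ) = r + (finSuccEquivLast.symm u : ℕ) :=
    fun u => by simp [vertexEquiv]
  have hl : ∀ l : Fin m × Option (Fin b), (vertexEquiv r b m (.inr (.inr l)) : ℕ) =
      r + ((b + 1) + ((finSuccEquivLast.symm l.2 : ℕ) + (b + 1) * l.1)) :=
    fun l => by simp [vertexEquiv]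
  have hlt : ∀ u : Option (Fin b), (finSuccEquivLast.symm u : ℕ) < b + 1 := fun u => Fin.is_lt _
  have hmod : ∀ (u c : ℕ), u < b + 1 → (u + (b + 1) * c) % (b + 1) = u := fun u c hu => by
    rw [Nat.add_mul_mod_self_left, Nat.mod_eq_of_lt hu]
  rcases v with p | u | l <;> rcases w with p' | u' | l'
  · simp only [hr, NatArc, reductionArc, iff_false]
    have := p.2
    have := p'.2
    rintro (⟨-, h | ⟨u, -, h, -⟩⟩ | ⟨u, -, c, -, h, -⟩) <;> omega
  · simp only [hr, hb, NatArc, reductionArc]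
    have hp := p.2
    rcases u' with _ | u'
    · simp [hp]
    · simp only [finSuccEquivLast_symm_some, Fin.val_castSucc, Option.mem_def,
        Option.some.injEq, forall_eq', ← hE]
      have hu := u'.2
      constructor
      · rintro (⟨-, h | ⟨u, -, h, he⟩⟩ | ⟨u, -, c, -, h, -⟩)
        · omega
        · rwa [show (u' : ℕ) = u by omega]
        · omega
      · exact fun h => Or.inl ⟨hp, Or.inr ⟨u', hu, rfl, h⟩⟩
  · simp only [hr, hl, NatArc, reductionArc, iff_false]
    have := p.2
    rintro (⟨-, h | ⟨u, hu, h, -⟩⟩ | ⟨u, -, c, -, h, -⟩) <;> omega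
  · simp only [hr, hb, NatArc, reductionArc, iff_false]
    have := p'.2
    rintro (⟨h, -⟩ | ⟨u, hu, c, -, -, h⟩) <;> omega
  · simp only [hb, NatArc, reductionArc, iff_false]
    have := hlt u'
    rintro (⟨h, -⟩ | ⟨u, hu, c, -, -, h⟩) <;> omega
  · simp only [hb, hl, NatArc, reductionArc]
    have h₁ := hlt u
    have h₂ := hlt l'.2
    constructor
    · rintro (⟨h, -⟩ | ⟨v, hv, c, -, h, h'⟩)
      · omega
      · apply finSuccEquivLast.symm.injective
        ext
        have h₃ := hmod _ l'.1 h₂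
        rw [show (finSuccEquivLast.symm l'.2 : ℕ) + (b + 1) * l'.1 = v + (b + 1) * c by omega,
          hmod v c hv] at h₃
        omega
    · rintro rfl
      exact Or.inr ⟨_, h₁, l'.1, l'.1.2, rfl, rfl⟩
  · simp only [hr, hl, NatArc, reductionArc, iff_false]
    have := p'.2
    rintro (⟨h, -⟩ | ⟨u, hu, c, -, h, -⟩) <;> omega
  · simp only [hb, hl, NatArc, reductionArc, iff_false]
    rintro (⟨h, -⟩ | ⟨u, hu, c, -, h, -⟩) <;> omega
  · simp only [hl, NatArc, reductionArc, iff_false]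
    rintro (⟨h, -⟩ | ⟨u, hu, c, -, h, -⟩) <;> omega

/-! ### The transformation -/

open Classical in
/-- The word of the graph to which an instance is mapped: the graph of the reduction, or a complete
bipartite graph with many vertices if the instance is malformed or has an isolated blue vertex. -/
noncomputable def outputWord (I : List Bool × ℕ) : List Bool :=
  if IsInstance I ∧ NoIsolated I.1 then
    graphWord (redCount I.1 + ((blueCount I.1 + 1) + (I.2 + 3) * (blueCount I.1 + 1)))
      fun p q => NatArc (redCount I.1) (blueCount I.1) (I.2 + 3) (IsEdge I.1) p q ∨
        NatArc (redCount I.1) (blueCount I.1) (I.2 + 3) (IsEdge I.1) q p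
  else
    graphWord ((I.2 + 3) + (I.2 + 3)) fun p q =>
      (p < I.2 + 3 ∧ I.2 + 3 ≤ q) ∨ (q < I.2 + 3 ∧ I.2 + 3 ≤ p)

theorem outputWord_of_not {I : List Bool × ℕ} (h : ¬ (IsInstance I ∧ NoIsolated I.1)) :
    outputWord I = encodeGraph (splitGraph (I.2 + 3) ((I.2 + 3) + (I.2 + 3))) := by
  rw [outputWord, if_neg h]
  exact (encodeGraph_eq_graphWord _ _ fun _ _ => Iff.rfl).symm

/-- Without isolated blue vertices this is the main reduction, transported along the vertex
numbering. With one, no dominating set exists and the complete bipartite graph needs at least `b + k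
+ 3` guards. -/
theorem exists_outputWord_encode {r b : ℕ} (G : RedBlueGraph r b) (k : ℕ) :
    ∃ (n : ℕ) (H : SimpleGraph (Fin n)),
      outputWord (encodeRedBlueGraph G, b + k) = encodeGraph H ∧ H.IsBipartite ∧ H.ediam ≤ 6 ∧
        (HasRedDominatingSet G k ↔ evc H ≤ b + k + 2) := by
  by_cases hG : ∀ u, ∃ r, G r u
  · let e := vertexEquiv r b (b + k + 3)
    let H := (reductionGraph (Fin (b + k + 3)) G).comap e.symm
    let i : reductionGraph (Fin (b + k + 3)) G ≃g H := (SimpleGraph.Iso.comap e.symm _).symm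
    refine ⟨_, H, ?_, ?_, i.ediam_le (reductionGraph_ediam_le hG), ?_⟩
    · rw [outputWord, if_pos ⟨isInstance_encode G k, (noIsolated_encode G).2 hG⟩]
      simp only [redCount_encode, blueCount_encode]
      refine (encodeGraph_eq_graphWord H _ fun v w => ?_).symm
      obtain ⟨v, rfl⟩ := e.surjective v
      obtain ⟨w, rfl⟩ := e.surjective w
      rw [natArc_vertexEquiv G _ (isEdge_encode G), natArc_vertexEquiv G _ (isEdge_encode G)]
      simp [H, reductionGraph]
    · exact reductionGraph_isBipartite.of_hom i.symm.toHom
    · have h := evc_reductionGraph_le_iff (R := Fin r) (B := Fin b) (L := Fin (b + k + 3))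
        (k := k) (G := G) (by simp) hG
      rw [evc_iso i, Fintype.card_fin] at h
      exact h.symm
  · refine ⟨_, splitGraph (b + k + 3) ((b + k + 3) + (b + k + 3)), ?_,
      splitGraph_isBipartite _ _, splitGraph_ediam_le (by omega), ?_⟩
    · exact outputWord_of_not fun h => hG ((noIsolated_encode G).1 h.2)
    · refine iff_of_false ?_ ?_
      · rintro ⟨S, -, hS⟩
        exact hG fun u => (hS u).imp fun r h => h.2
      · have := le_evc_splitGraph (b + k + 3)
        omega

/-! ### Polynomial-time computability of the transformation. -/

section Computable

variable {ι β : Type} {Δ : ι → β → List Bool} {x : β → List Bool} {r b m p q : β → ℕ}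

theorem Comp.redCount (hx : Comp Δ x) : CompNat Δ fun t => redCount (x t) := hx.leadingOnes

theorem Comp.dropRed (hx : Comp Δ x) : Comp Δ fun t => (x t).drop (_root_.redCount (x t) + 1) :=
  hx.drop (hx.redCount.add (CompNat.const 1))

theorem Comp.blueCount (hx : Comp Δ x) : CompNat Δ fun t => blueCount (x t) :=
  hx.dropRed.leadingOnes

theorem Comp.isEdge (hx : Comp Δ x) (hp : CompNat Δ p) (hq : CompNat Δ q) :
    CompPred Δ fun t => IsEdge (x t) (p t) (q t) :=
  CompPred.getElem? (hx.dropRed.drop (hx.blueCount.add (CompNat.const 1)))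
    ((hp.mul hx.blueCount).add hq)

theorem Comp.natArc (hx : Comp Δ x) (hm : CompNat Δ m) (hp : CompNat Δ p) (hq : CompNat Δ q) :
    CompPred Δ fun t =>
      NatArc (_root_.redCount (x t)) (_root_.blueCount (x t)) (m t) (IsEdge (x t)) (p t) (q t) := by
  have hr := hx.redCount
  have hb := hx.blueCount
  have hb1 := hb.add (CompNat.const 1)
  refine ((CompPred.lt hp hr).and ((CompPred.eq hq (hr.add hb)).or
    (CompPred.exists_lt hb ((CompPred.eq hq.up (hr.up.add CompNat.snd)).and
      (hx.up.isEdge hp.up CompNat.snd))))).or ?_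
  exact CompPred.exists_lt hb1 (CompPred.exists_lt hm.up
    ((CompPred.eq hp.up.up (hr.up.up.add CompNat.snd.up)).and
      (CompPred.eq hq.up.up (hr.up.up.add (hb1.up.up.add
        (CompNat.snd.up.add (hb1.up.up.mul CompNat.snd)))))))

theorem Comp.graphWord {N : β → ℕ} {A : β → ℕ → ℕ → Prop} (hN : CompNat Δ N)
    (hA : CompPred (withNat (withNat Δ)) fun t => A t.1.1 t.1.2 t.2) :
    Comp Δ fun t => graphWord (N t) (A t) :=
  Comp.append hN (Comp.append (Comp.bit false)
    (Comp.flatMap_range hN (Comp.flatMap_range hN.up (Comp.decide hA))))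

theorem comp_outputWord {X : β → List Bool × ℕ} (hx : Comp Δ fun t => (X t).1)
    (hk : CompNat Δ fun t => (X t).2) : Comp Δ fun t => outputWord (X t) := by
  have hr := hx.redCount
  have hb := hx.blueCount
  have hb1 := hb.add (CompNat.const 1)
  have hm := hk.add (CompNat.const 3)
  have hI : CompPred Δ fun t => IsInstance (X t) ∧ NoIsolated (X t).1 :=
    ((CompPred.eq hx.length (((hr.add hb).add (hr.mul hb)).add (CompNat.const 2))).and
      (CompPred.le hb hk)).and (CompPred.forall_lt hb (CompPred.exists_lt hr.up
        (hx.up.up.isEdge CompNat.snd CompNat.snd.up)))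
  unfold outputWord
  convert Comp.ite hI ?_ ?_
  · exact Comp.graphWord (hr.add (hb1.add (hm.mul hb1)))
      ((hx.up.up.natArc hm.up.up CompNat.snd.up CompNat.snd).or
        (hx.up.up.natArc hm.up.up CompNat.snd CompNat.snd.up))
  · exact Comp.graphWord (hm.add hm)
      (((CompPred.lt CompNat.snd.up hm.up.up).and (CompPred.le hm.up.up CompNat.snd)).or
        ((CompPred.lt CompNat.snd hm.up.up).and (CompPred.le hm.up.up CompNat.snd.up)))

/-- The leading ones of the input word are `κ` in unary; dropping them and the separator leaves the
word of the graph. -/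
theorem comp_transformation : Comp (fun _ : Unit => encodeInstance) fun I =>
    encodeInstance (outputWord I, I.2 + 2) := by
  have h := Comp.var (Γ := fun _ : Unit => encodeInstance) ()
  have hk : CompNat (fun _ : Unit => encodeInstance) fun I => I.2 := by
    have h₁ := h.leadingOnes
    simp only [encodeInstance, leadingOnes_replicate_append] at h₁
    exact h₁
  have hx : Comp (fun _ : Unit => encodeInstance) fun I => I.1 := by
    have h₁ := h.drop (hk.add (CompNat.const 1))
    simp only [encodeInstance, drop_replicate_append] at h₁
    exact h₁
  exact Comp.append (hk.add (CompNat.const 2)) (Comp.append (Comp.bit false)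
    (comp_outputWord hx hk))

end Computable

theorem mainTheorem2 :
    ∃ f : List Bool × ℕ → List Bool × ℕ,
      IsPolynomialParameterTransformation
        RedBlueDominatingSetProblem EternalVertexCoverProblem f ∧
      ∀ (r b : ℕ) (G : RedBlueGraph r b) (k : ℕ),
        ∃ (n : ℕ) (H : SimpleGraph (Fin n)),
          f (encodeRedBlueGraph G, b + k) = (encodeGraph H, b + k + 2) ∧
          H.IsBipartite ∧ H.ediam ≤ 6 ∧
          (HasRedDominatingSet G k ↔ evc H ≤ b + k + 2) := by
  refine ⟨fun I => (outputWord I, I.2 + 2), ⟨comp_transformation.computableInPolyTime,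
    fun x κ => ⟨?_, ?_⟩, Polynomial.X + 2, fun x κ => by simp⟩, fun r b G k => ?_⟩
  · rintro ⟨r, b, G, k, hI, hG⟩
    obtain ⟨n, H, hH, -, -, h⟩ := exists_outputWord_encode G k
    rw [hI]
    exact ⟨n, H, b + k + 2, by omega, Prod.ext hH rfl, h.1 hG⟩
  · rintro ⟨n, H, l, -, hI, hl⟩
    obtain ⟨hw, rfl⟩ := Prod.mk.inj hI
    by_cases hx : IsInstance (x, κ)
    · obtain ⟨r, b, G, k, hxG⟩ := hx.exists_encode
      obtain ⟨n', H', hH', -, -, h⟩ := exists_outputWord_encode G k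
      refine ⟨r, b, G, k, hxG, h.2 ?_⟩
      -- The graph witnessing the yes-instance and the graph of the reduction have the same word,
      -- hence the same `evc`.
      rw [← hxG, hw] at hH'
      rw [← encodeGraph_injective hH']
      obtain ⟨-, rfl⟩ := Prod.mk.inj hxG
      exact hl
    -- A malformed word cannot map to a yes-instance: its graph needs at least `κ + 3` guards, but
    -- only `κ + 2` are allowed.
    · rw [outputWord_of_not fun h => hx h.1] at hw
      have h₁ := le_evc_splitGraph (κ + 3)
      rw [encodeGraph_injective hw] at h₁
      simp only at hl
      omega
  · obtain ⟨n, H, hH, h⟩ := exists_outputWord_encode G k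
    exact ⟨n, H, Prod.ext hH rfl, h⟩
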